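/- **Definitions.** A *uniform preorder* $\mathfrak A=(I,A,R)$ consists of a set $I$ of sorts, a family of sets $(A_i)_{i\in I}$ and sets of relations $R_{ij}\subseteq P(A_i\times A_j)$ ($i,j\in I$) such that: if $r\in R_{ij}$ and $s\subseteq r$ then $s\in R_{ij}$; $\mathrm{id}_{A_i}\in R_{ii}$; and if $r\in R_{ij}$, $s\in R_{jk}$ then the composite $sr=\{(a,c)\mid\exists b.\ r(a,b)\wedge s(b,c)\}$ is in $R_{ik}$. It is *finitely complete* if it is equipped with $1\in I$, $\top\in A_1$, $*:I\times I\to I$ and maps $\wedge:A_i\times A_j\to A_{i*j}$ such that for $r\in R_{ij}$, $s\in R_{kl}$ one has $\{(a\wedge c,b\wedge d)\mid r(a,b),\,s(c,d)\}\in R_{i*k,\,j*l}$, and the relations $\{(a\wedge b,a)\}$, $\{(a\wedge b,b)\}$, $\{(a,a\wedge a)\}$, $\{(a,\top)\}$ belong to $R_{i*j,i}$, $R_{i*j,j}$, $R_{i,i*i}$, $R_{i,1}$ respectively. The fibered preorder $\mathrm{ufam}(\mathfrak A)$ on $\mathbf{Set}$ has as predicates on a set $M$ the pairs $(i\in I,\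 \varphi:M\to A_i)$, with $(i,\varphi)\le(j,\psi)$ iff $\{(\varphi m,\psi m)\mid m\in M\}\in R_{ij}$; reindexing is precomposition. $D\mathfrak A$ is the uniform preorder with sorts $I$ and sets $P(A_i)$ in which a relation from $P(A_i)$ to $P(A_j)$ is distinguished iff it is contained in $[r]=\{(M,N)\mid\forall m\in M\,\exists n\in N.\ r(m,n)\}$ for some $r\in R_{ij}$ (the free completion under existential quantification). If $\mathfrak A$ is finitely complete then so is $D\mathfrak A$, with top $\{\top\}$ and $M\wedge N=\{a\wedge b\mid a\in M,\,b\in N\}$. A finitely complete uniform preorder $\mathfrak B$ *has implication* if all fibers of $\mathrm{ufam}(\mathfrak B)$ have Heyting implications ($\xi\le(\varphi\Rightarrow\psi)$ iff $\xi\wedge\varphi\le\psi$) and reindexing preserves them; it *has universal quantification* if for each function $u$ the reindexing $u^*$ has a right adjoint $\forall_u$, and these satisfy the Beck–Chevalley condition for all pullback squares of sets. Let $\mathrm{UFam}(\mathfrak A)$ be the total category of $\mathrm{ufam}(\mathfrak A)$: objects are pairs $(M,\varphi)$ of a set and a predicate on it, and morphisms $(M,\varphi)\to(N,\psi)$ are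 functions $f$ with $\varphi\le f^*\psi$. It has finite limits when $\mathfrak A$ is finitely complete. The *fibration of sieves* has as predicates on $X\in\mathrm{UFam}(\mathfrak A)$ the morphisms $f:Y\to X$, with $(f:Y\to X)\le(g:Z\to X)$ iff there are $e:Y'\to Y$ and $k:Y'\to Z$ with $gk=fe$, where $e$ is a cartesian morphism over a surjection. Reindexing and conjunction are given by pullback, existential quantification by postcomposition. $\mathbf{Set}\{\mathfrak A\}$ is the category whose objects are pairs $(C,\rho)$ of an object $C$ and a (total) equivalence relation $\rho$ on $C$ in the fibration of sieves. Its morphisms $(C,\rho)\to(D,\sigma)$ are the predicates $\phi$ on $C\times D$ such that $$\phi(c,d)\vdash\rho(c,c)\wedge\sigma(d,d),\qquad \phi(c,d),\rho(c,c'),\sigma(d,d')\vdash\phi(c',d'),$$ $$\phi(c,d),\phi(c,d')\vdash\sigma(d,d'),\qquad \rho(c,c)\vdash\exists d.\,\phi(c,d)$$ hold in the fibration of sieves, taken up to logical equivalence and composed as relations. **Theorem.** Let $\mathfrak A=(I,A,R)$ be a finitely complete uniform preorder. The following are equivalent. 1. $\mathfrak A$ is *relationally complete*: for all $j,k\in I$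 there exist a sort $(j\Rightarrow k)\in I$ and a relation $@\in R_{(j\Rightarrow k)*j,\,k}$ such that for all $i\in I$ and $r\in R_{i*j,\,k}$ there exists $\tilde r\in R_{i,\,j\Rightarrow k}$ with $$\forall a\in A_i\ \exists h\in A_{j\Rightarrow k}.\quad \tilde r(a,h)\ \wedge\ \forall b\in A_j\,\forall c\in A_k.\ \bigl(r(a\wedge b,c)\Rightarrow @(h\wedge b,c)\bigr).$$ 2. $D\mathfrak A$ has implication and universal quantification. 3. $\mathbf{Set}\{\mathfrak A\}$ is locally cartesian closed, i.e. each of its slice categories is cartesian closed. -/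

import Mathlib

open CategoryTheory

universe u

/-- A uniform preorder `(I, A, R)`: a family of sets `A i` indexed by a set `I` of sorts, with for
each pair of sorts a set `R i j` of relations from `A i` to `A j`, closed under subrelations and
composition and containing the identity relations. -/
structure UniformPreorder where
  /-- the set of sorts -/
  Idx : Type u
  /-- the underlying family of sets -/
  Car : Idx → Type u
  /-- the distinguished sets of relations -/
  Rel : ∀ i j : Idx, Set (Car i → Car j → Prop)
  down : ∀ {i j : Idx} {r s : Car i → Car j → Prop},
    r ∈ Rel i j → (∀ a b, s a b → r a b) → s ∈ Rel i j
  id_mem : ∀ i : Idx, (fun a b : Car i => a = b) ∈ Rel i i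
  comp_mem : ∀ {i j k : Idx} {r : Car i → Car j → Prop} {s : Car j → Car k → Prop},
    r ∈ Rel i j → s ∈ Rel j k → Relation.Comp r s ∈ Rel i k

namespace UniformPreorder

/-! ### Finite completeness and relational completeness -/

/-- Finite completeness: the (chosen) right adjoints `(*, ∧)` and `(1, ⊤)` of the diagonal
`𝔄 → 𝔄 × 𝔄` and of `𝔄 → 1`, spelled out. -/
class FinitelyComplete (𝔄 : UniformPreorder.{u}) where
  /-- the sort `1` -/
  one : 𝔄.Idx
  /-- the element `⊤ ∈ A 1` -/
  top : 𝔄.Car one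
  /-- the operation `*` on sorts -/
  star : 𝔄.Idx → 𝔄.Idx → 𝔄.Idx
  /-- the maps `∧ : A i × A j → A (i * j)` -/
  meet : ∀ {i j : 𝔄.Idx}, 𝔄.Car i → 𝔄.Car j → 𝔄.Car (star i j)
  meet_mono : ∀ {i j k l : 𝔄.Idx} {r : 𝔄.Car i → 𝔄.Car j → Prop}
    {s : 𝔄.Car k → 𝔄.Car l → Prop}, r ∈ 𝔄.Rel i j → s ∈ 𝔄.Rel k l →
    (fun x y => ∃ a b c d, r a b ∧ s c d ∧ x = meet a c ∧ y = meet b d)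
      ∈ 𝔄.Rel (star i k) (star j l)
  meet_left : ∀ i j : 𝔄.Idx,
    (fun x y => ∃ (a : 𝔄.Car i) (b : 𝔄.Car j), x = meet a b ∧ y = a) ∈ 𝔄.Rel (star i j) i
  meet_right : ∀ i j : 𝔄.Idx,
    (fun x y => ∃ (a : 𝔄.Car i) (b : 𝔄.Car j), x = meet a b ∧ y = b) ∈ 𝔄.Rel (star i j) j
  meet_diag : ∀ i : 𝔄.Idx, (fun (a : 𝔄.Car i) y => y = meet a a) ∈ 𝔄.Rel i (star i i)
  le_top : ∀ i : 𝔄.Idx, (fun (_ : 𝔄.Car i) y => y = top) ∈ 𝔄.Rel i one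

open FinitelyComplete

/-- Relational completeness. -/
def RelationallyComplete (𝔄 : UniformPreorder.{u}) [FinitelyComplete 𝔄] : Prop :=
  ∀ j k : 𝔄.Idx, ∃ (jk : 𝔄.Idx) (ev : 𝔄.Car (star jk j) → 𝔄.Car k → Prop),
    ev ∈ 𝔄.Rel (star jk j) k ∧
    ∀ (i : 𝔄.Idx) (r : 𝔄.Car (star i j) → 𝔄.Car k → Prop), r ∈ 𝔄.Rel (star i j) k →
      ∃ r' : 𝔄.Car i → 𝔄.Car jk → Prop, r' ∈ 𝔄.Rel i jk ∧
        ∀ a : 𝔄.Car i, ∃ h : 𝔄.Car jk, r' a h ∧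
          ∀ (b : 𝔄.Car j) (c : 𝔄.Car k), r (meet a b) c → ev (meet h b) c

/-! ### The fibered preorder of a uniform preorder -/

/-- A predicate on the set `M` in the fibered preorder `ufam 𝔄`. -/
structure Pred (𝔄 : UniformPreorder.{u}) (M : Type u) where
  /-- the sort of the predicate -/
  idx : 𝔄.Idx
  /-- the underlying function -/
  fn : M → 𝔄.Car idx

namespace Pred

variable {𝔄 : UniformPreorder.{u}} {M N : Type u}

/-- Reindexing is precomposition. -/
def reindex (f : N → M) (φ : 𝔄.Pred M) : 𝔄.Pred N := ⟨φ.idx, fun n => φ.fn (f n)⟩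

instance : LE (𝔄.Pred M) :=
  ⟨fun φ ψ => (fun a b => ∃ m, φ.fn m = a ∧ ψ.fn m = b) ∈ 𝔄.Rel φ.idx ψ.idx⟩

theorem le_def {φ ψ : 𝔄.Pred M} :
    φ ≤ ψ ↔ (fun a b => ∃ m, φ.fn m = a ∧ ψ.fn m = b) ∈ 𝔄.Rel φ.idx ψ.idx := Iff.rfl

/-- A predicate inequality holds as soon as some distinguished relation realizes it. -/
theorem le_of {φ ψ : 𝔄.Pred M} {r : 𝔄.Car φ.idx → 𝔄.Car ψ.idx → Prop}
    (hr : r ∈ 𝔄.Rel φ.idx ψ.idx) (h : ∀ m, r (φ.fn m) (ψ.fn m)) : φ ≤ ψ := by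
  refine 𝔄.down hr ?_
  rintro _ _ ⟨m, rfl, rfl⟩
  exact h m

instance : Preorder (𝔄.Pred M) where
  le_refl φ := le_of (𝔄.id_mem _) fun _ => rfl
  le_trans φ ψ χ h₁ h₂ := le_of (𝔄.comp_mem h₁ h₂) fun m => ⟨ψ.fn m, ⟨m, rfl, rfl⟩, ⟨m, rfl, rfl⟩⟩

theorem reindex_mono (f : N → M) {φ ψ : 𝔄.Pred M} (h : φ ≤ ψ) : φ.reindex f ≤ ψ.reindex f :=
  le_of (φ := φ.reindex f) (ψ := ψ.reindex f) h fun n => ⟨f n, rfl, rfl⟩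

variable [FinitelyComplete 𝔄]

/-- The greatest predicate on `M`. -/
def tt : 𝔄.Pred M := ⟨one, fun _ => top⟩

/-- The meet of two predicates. -/
def inf (φ ψ : 𝔄.Pred M) : 𝔄.Pred M := ⟨star φ.idx ψ.idx, fun m => meet (φ.fn m) (ψ.fn m)⟩

theorem le_tt (φ : 𝔄.Pred M) : φ ≤ tt :=
  le_of (ψ := tt) (le_top φ.idx) fun _ => rfl

theorem inf_le_left (φ ψ : 𝔄.Pred M) : inf φ ψ ≤ φ :=
  le_of (φ := inf φ ψ) (meet_left φ.idx ψ.idx) fun _ => ⟨_, _, rfl, rfl⟩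

theorem inf_le_right (φ ψ : 𝔄.Pred M) : inf φ ψ ≤ ψ :=
  le_of (φ := inf φ ψ) (meet_right φ.idx ψ.idx) fun _ => ⟨_, _, rfl, rfl⟩

theorem le_inf {ξ φ ψ : 𝔄.Pred M} (h₁ : ξ ≤ φ) (h₂ : ξ ≤ ψ) : ξ ≤ inf φ ψ :=
  le_of (ψ := inf φ ψ) (𝔄.comp_mem (meet_diag ξ.idx) (meet_mono h₁ h₂))
    fun m => ⟨_, rfl, _, _, _, _, ⟨m, rfl, rfl⟩, ⟨m, rfl, rfl⟩, rfl, rfl⟩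

/-- `χ` is a Heyting implication `φ ⇒ ψ` in the fiber over `M`. -/
def IsImp (φ ψ χ : 𝔄.Pred M) : Prop := ∀ ξ : 𝔄.Pred M, ξ ≤ χ ↔ inf ξ φ ≤ ψ

/-- `χ` is a universal quantification `∀_u φ` of `φ` along `u`. -/
def IsAll (u : N → M) (φ : 𝔄.Pred N) (χ : 𝔄.Pred M) : Prop :=
  ∀ ξ : 𝔄.Pred M, ξ ≤ χ ↔ ξ.reindex u ≤ φ

end Pred

/-- A finitely complete uniform preorder has implication: the fibers of `ufam 𝔅` have all
implications, and these are preserved by reindexing. -/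
def HasImplication (𝔅 : UniformPreorder.{u}) [FinitelyComplete 𝔅] : Prop :=
  (∀ (M : Type u) (φ ψ : 𝔅.Pred M), ∃ χ, Pred.IsImp φ ψ χ) ∧
  (∀ (M N : Type u) (f : N → M) (φ ψ χ : 𝔅.Pred M), Pred.IsImp φ ψ χ →
    Pred.IsImp (φ.reindex f) (ψ.reindex f) (χ.reindex f))

/-- The square of functions with top `p`, left `q`, right `u`, bottom `w` is a pullback. -/
def IsPullbackSquare {P X Z Y : Type u} (p : P → X) (q : P → Z) (u : X → Y) (w : Z → Y) : Prop :=
  (∀ t, u (p t) = w (q t)) ∧ ∀ x z, u x = w z → ∃! t, p t = x ∧ q t = z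

/-- A uniform preorder has universal quantification: in `ufam 𝔅` all reindexing maps have right
adjoints, and these satisfy the Beck-Chevalley condition. -/
def HasUniversalQuantification (𝔅 : UniformPreorder.{u}) : Prop :=
  (∀ (X Y : Type u) (u : X → Y) (φ : 𝔅.Pred X), ∃ χ, Pred.IsAll u φ χ) ∧
  (∀ (P X Z Y : Type u) (p : P → X) (q : P → Z) (u : X → Y) (w : Z → Y),
    IsPullbackSquare p q u w → ∀ (φ : 𝔅.Pred X) (χ : 𝔅.Pred Y), Pred.IsAll u φ χ →
      Pred.IsAll q (φ.reindex p) (χ.reindex w))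

/-! ### The free completion under existential quantification -/

/-- The relation `[r]` between sets induced by a relation `r`. -/
def liftRel {α β : Type u} (r : α → β → Prop) (M : Set α) (N : Set β) : Prop :=
  ∀ m ∈ M, ∃ n ∈ N, r m n

/-- The uniform preorder `D 𝔄` on the power sets `P (A i)`, generated by the relations `[r]`. -/
def D (𝔄 : UniformPreorder.{u}) : UniformPreorder.{u} where
  Idx := 𝔄.Idx
  Car i := Set (𝔄.Car i)
  Rel i j := {t | ∃ r ∈ 𝔄.Rel i j, ∀ M N, t M N → liftRel r M N}
  down := by
    rintro i j t s ⟨r, hr, h⟩ hs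
    exact ⟨r, hr, fun M N hMN => h M N (hs M N hMN)⟩
  id_mem i := ⟨_, 𝔄.id_mem i, by rintro M _ rfl m hm; exact ⟨m, hm, rfl⟩⟩
  comp_mem := by
    rintro i j k t t' ⟨r, hr, h⟩ ⟨s, hs, h'⟩
    refine ⟨_, 𝔄.comp_mem hr hs, ?_⟩
    rintro M P ⟨N, hMN, hNP⟩ m hm
    obtain ⟨n, hn, hmn⟩ := h M N hMN m hm
    obtain ⟨p, hp, hnp⟩ := h' N P hNP n hn
    exact ⟨p, hp, n, hmn, hnp⟩

/-- Finite meets in `D 𝔄`. -/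
instance (𝔄 : UniformPreorder.{u}) [FinitelyComplete 𝔄] : FinitelyComplete (D 𝔄) where
  one := (one : 𝔄.Idx)
  top := ({top} : Set (𝔄.Car one))
  star i j := (star (𝔄 := 𝔄) i j : 𝔄.Idx)
  meet {i j} (M : Set (𝔄.Car i)) (N : Set (𝔄.Car j)) :=
    ({x | ∃ a ∈ M, ∃ b ∈ N, x = meet a b} : Set (𝔄.Car (star i j)))
  meet_mono := by
    rintro i j k l t t' ⟨r, hr, h⟩ ⟨s, hs, h'⟩
    refine ⟨_, meet_mono hr hs, ?_⟩
    rintro _ _ ⟨M, N, M', N', hMN, hMN', rfl, rfl⟩ _ ⟨a, ha, c, hc, rfl⟩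
    obtain ⟨b, hb, hab⟩ := h M N hMN a ha
    obtain ⟨d, hd, hcd⟩ := h' M' N' hMN' c hc
    exact ⟨_, ⟨b, hb, d, hd, rfl⟩, a, b, c, d, hab, hcd, rfl, rfl⟩
  meet_left i j := by
    refine ⟨_, meet_left (𝔄 := 𝔄) i j, ?_⟩
    rintro _ _ ⟨M, N, rfl, rfl⟩ _ ⟨a, ha, b, hb, rfl⟩
    exact ⟨a, ha, a, b, rfl, rfl⟩
  meet_right i j := by
    refine ⟨_, meet_right (𝔄 := 𝔄) i j, ?_⟩
    rintro _ _ ⟨M, N, rfl, rfl⟩ _ ⟨a, ha, b, hb, rfl⟩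
    exact ⟨b, hb, a, b, rfl, rfl⟩
  meet_diag i := by
    refine ⟨_, meet_diag (𝔄 := 𝔄) i, ?_⟩
    rintro M _ rfl a ha
    exact ⟨_, ⟨a, ha, a, ha, rfl⟩, rfl⟩
  le_top i := by
    refine ⟨_, le_top (𝔄 := 𝔄) i, ?_⟩
    rintro M _ rfl a ha
    exact ⟨_, rfl, rfl⟩

/-! ### The total category of `ufam 𝔄` -/

/-- Objects of the total category of `ufam 𝔄`: sets with a predicate. -/
structure UFam (𝔄 : UniformPreorder.{u}) where
  /-- the underlying set -/
  base : Type u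
  /-- the predicate on it -/
  pred : 𝔄.Pred base

namespace UFam

variable {𝔄 : UniformPreorder.{u}}

/-- Morphisms `(M, φ) → (N, ψ)` are functions `f` with `φ ≤ f^* ψ`. -/
@[ext]
structure Hom (X Y : 𝔄.UFam) where
  /-- the underlying function -/
  fn : X.base → Y.base
  le : X.pred ≤ Y.pred.reindex fn

instance : Category 𝔄.UFam where
  Hom := Hom
  id X := ⟨fun x => x, le_refl X.pred⟩
  comp f g := ⟨fun x => g.fn (f.fn x), le_trans f.le (Pred.reindex_mono f.fn g.le)⟩

@[ext]
theorem hom_ext {X Y : 𝔄.UFam} {f g : X ⟶ Y} (h : ∀ x, Hom.fn f x = Hom.fn g x) : f = g :=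
  Hom.ext (funext h)

@[simp]
theorem id_fn (X : 𝔄.UFam) (x : X.base) : Hom.fn (𝟙 X) x = x := rfl

@[simp]
theorem comp_fn {X Y Z : 𝔄.UFam} (f : X ⟶ Y) (g : Y ⟶ Z) (x : X.base) :
    Hom.fn (f ≫ g) x = Hom.fn g (Hom.fn f x) := rfl

theorem fn_congr {X Y : 𝔄.UFam} {f g : X ⟶ Y} (h : f = g) (x : X.base) :
    Hom.fn f x = Hom.fn g x := by rw [h]

/-- Cover-cartesian maps: cartesian maps over surjections. -/
def CoverCartesian {X Y : 𝔄.UFam} (e : X ⟶ Y) : Prop :=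
  Function.Surjective (Hom.fn e) ∧ Y.pred.reindex (Hom.fn e) ≤ X.pred

/-- With choice, cover-cartesian maps have sections. -/
theorem CoverCartesian.exists_section {X Y : 𝔄.UFam} {e : X ⟶ Y} (he : CoverCartesian e) :
    ∃ s : Y ⟶ X, s ≫ e = 𝟙 Y := by
  have hs : ∀ y, Hom.fn e (Function.surjInv he.1 y) = y := Function.surjInv_eq he.1
  refine ⟨⟨Function.surjInv he.1, ?_⟩, hom_ext hs⟩
  have h := Pred.reindex_mono (Function.surjInv he.1) he.2
  have h' : (Y.pred.reindex (Hom.fn e)).reindex (Function.surjInv he.1) = Y.pred := by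
    simp [Pred.reindex, hs]
  rwa [h'] at h

variable [FinitelyComplete 𝔄]

/-- The product of two objects. -/
def prod (X Y : 𝔄.UFam) : 𝔄.UFam :=
  ⟨X.base × Y.base, Pred.inf (X.pred.reindex Prod.fst) (Y.pred.reindex Prod.snd)⟩

/-- First projection. -/
def fst (X Y : 𝔄.UFam) : prod X Y ⟶ X := ⟨Prod.fst, Pred.inf_le_left _ _⟩

/-- Second projection. -/
def snd (X Y : 𝔄.UFam) : prod X Y ⟶ Y := ⟨Prod.snd, Pred.inf_le_right _ _⟩

/-- Pairing. -/
def pair {W X Y : 𝔄.UFam} (f : W ⟶ X) (g : W ⟶ Y) : W ⟶ prod X Y :=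
  ⟨fun w => (Hom.fn f w, Hom.fn g w), Pred.le_inf (Hom.le f) (Hom.le g)⟩

@[simp]
theorem fst_fn (X Y : 𝔄.UFam) (z : X.base × Y.base) : Hom.fn (fst X Y) z = z.1 := rfl

@[simp]
theorem snd_fn (X Y : 𝔄.UFam) (z : X.base × Y.base) : Hom.fn (snd X Y) z = z.2 := rfl

@[simp]
theorem pair_fn {W X Y : 𝔄.UFam} (f : W ⟶ X) (g : W ⟶ Y) (w : W.base) :
    Hom.fn (pair f g) w = (Hom.fn f w, Hom.fn g w) := rfl

@[simp]
theorem pair_fst {W X Y : 𝔄.UFam} (f : W ⟶ X) (g : W ⟶ Y) : pair f g ≫ fst X Y = f := rfl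

@[simp]
theorem pair_snd {W X Y : 𝔄.UFam} (f : W ⟶ X) (g : W ⟶ Y) : pair f g ≫ snd X Y = g := rfl

@[simp]
theorem comp_pair {V W X Y : 𝔄.UFam} (h : V ⟶ W) (f : W ⟶ X) (g : W ⟶ Y) :
    h ≫ pair f g = pair (h ≫ f) (h ≫ g) := rfl

theorem eq_pair {W X Y : 𝔄.UFam} (h : W ⟶ prod X Y) : h = pair (h ≫ fst X Y) (h ≫ snd X Y) := rfl

/-- The pullback of `f : X ⟶ Z` and `g : Y ⟶ Z`. -/
def pb {X Y Z : 𝔄.UFam} (f : X ⟶ Z) (g : Y ⟶ Z) : 𝔄.UFam :=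
  ⟨{z : X.base × Y.base // Hom.fn f z.1 = Hom.fn g z.2},
    Pred.inf (X.pred.reindex fun z => z.1.1) (Y.pred.reindex fun z => z.1.2)⟩

/-- First projection of the pullback. -/
def pbFst {X Y Z : 𝔄.UFam} (f : X ⟶ Z) (g : Y ⟶ Z) : pb f g ⟶ X :=
  ⟨fun z => z.1.1, Pred.inf_le_left _ _⟩

/-- Second projection of the pullback. -/
def pbSnd {X Y Z : 𝔄.UFam} (f : X ⟶ Z) (g : Y ⟶ Z) : pb f g ⟶ Y :=
  ⟨fun z => z.1.2, Pred.inf_le_right _ _⟩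

theorem pb_condition {X Y Z : 𝔄.UFam} (f : X ⟶ Z) (g : Y ⟶ Z) :
    pbFst f g ≫ f = pbSnd f g ≫ g := hom_ext fun z => z.2

/-- The universal property of the pullback. -/
theorem exists_pbLift {W X Y Z : 𝔄.UFam} {f : X ⟶ Z} {g : Y ⟶ Z} (h : W ⟶ X) (k : W ⟶ Y)
    (w : h ≫ f = k ≫ g) : ∃ l : W ⟶ pb f g, l ≫ pbFst f g = h ∧ l ≫ pbSnd f g = k :=
  ⟨⟨fun x => ⟨(Hom.fn h x, Hom.fn k x), fn_congr w x⟩, Pred.le_inf (Hom.le h) (Hom.le k)⟩, rfl, rfl⟩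

end UFam

/-! ### The fibration of sieves -/

/-- A predicate on `X` in the fibration of sieves `siev (ufam 𝔄)`: a morphism into `X`. -/
structure Siev {𝔄 : UniformPreorder.{u}} (X : 𝔄.UFam) where
  /-- the domain -/
  dom : 𝔄.UFam
  /-- the morphism -/
  arr : dom ⟶ X

namespace Siev

open UFam

variable {𝔄 : UniformPreorder.{u}} {X Y W : 𝔄.UFam}

/-- `f ≤ g` if `f` factors through `g` after precomposition with a cover-cartesian map. -/
instance : LE (Siev X) :=
  ⟨fun f g => ∃ (Y' : 𝔄.UFam) (e : Y' ⟶ f.dom) (k : Y' ⟶ g.dom),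
    CoverCartesian e ∧ k ≫ g.arr = e ≫ f.arr⟩

/-- The truth of the predicate `P` at the generalized element `x`. -/
def Sat (P : Siev X) (x : W ⟶ X) : Prop := ∃ h : W ⟶ P.dom, h ≫ P.arr = x

theorem Sat.comp {P : Siev X} {x : W ⟶ X} (h : P.Sat x) {V : 𝔄.UFam} (v : V ⟶ W) :
    P.Sat (v ≫ x) := by
  obtain ⟨k, rfl⟩ := h
  exact ⟨v ≫ k, by simp⟩

theorem sat_arr (P : Siev X) : P.Sat P.arr := ⟨𝟙 _, by simp⟩

theorem le_iff_sat_arr {P Q : Siev X} : P ≤ Q ↔ Q.Sat P.arr := by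
  constructor
  · rintro ⟨Y', e, k, he, hk⟩
    obtain ⟨s, hs⟩ := he.exists_section
    exact ⟨s ≫ k, by rw [Category.assoc, hk, ← Category.assoc, hs, Category.id_comp]⟩
  · rintro ⟨h, hh⟩
    exact ⟨P.dom, 𝟙 _, h, ⟨Function.surjective_id, le_refl P.dom.pred⟩, by simpa using hh⟩

theorem le_iff_sat {P Q : Siev X} : P ≤ Q ↔ ∀ (W : 𝔄.UFam) (x : W ⟶ X), P.Sat x → Q.Sat x := by
  rw [le_iff_sat_arr]
  constructor
  · rintro h W x ⟨k, rfl⟩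
    exact h.comp k
  · exact fun h => h _ _ P.sat_arr

instance : Preorder (Siev X) where
  le_refl P := le_iff_sat.2 fun _ _ h => h
  le_trans P Q R h₁ h₂ := le_iff_sat.2 fun W x h => le_iff_sat.1 h₂ W x (le_iff_sat.1 h₁ W x h)

/-- The true predicate. -/
def tt (X : 𝔄.UFam) : Siev X := ⟨X, 𝟙 X⟩

/-- Existential quantification along `u` is postcomposition. -/
def ex (u : X ⟶ Y) (P : Siev X) : Siev Y := ⟨P.dom, P.arr ≫ u⟩

theorem sat_tt (x : W ⟶ X) : (tt X).Sat x := ⟨x, by simp [tt]⟩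

theorem sat_ex {u : X ⟶ Y} {P : Siev X} {y : W ⟶ Y} :
    (ex u P).Sat y ↔ ∃ x : W ⟶ X, P.Sat x ∧ x ≫ u = y := by
  constructor
  · rintro ⟨h, rfl⟩
    exact ⟨h ≫ P.arr, ⟨h, rfl⟩, rfl⟩
  · rintro ⟨_, ⟨h, rfl⟩, rfl⟩
    exact ⟨h, (Category.assoc _ _ _).symm⟩

variable [FinitelyComplete 𝔄]

/-- Reindexing along `x` is pullback. -/
def reindex (x : W ⟶ X) (P : Siev X) : Siev W := ⟨pb x P.arr, pbFst x P.arr⟩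

/-- Conjunction is pullback. -/
def inf (P Q : Siev X) : Siev X := ⟨pb P.arr Q.arr, pbFst P.arr Q.arr ≫ P.arr⟩

/-- `P[s, t]`: substitution of the terms `s`, `t` into the binary predicate `P`. -/
def sub {C D : 𝔄.UFam} (P : Siev (prod C D)) (s : W ⟶ C) (t : W ⟶ D) : Siev W :=
  P.reindex (pair s t)

theorem sat_reindex {V : 𝔄.UFam} {x : W ⟶ X} {P : Siev X} {v : V ⟶ W} :
    (P.reindex x).Sat v ↔ P.Sat (v ≫ x) := by
  constructor
  · rintro ⟨h, rfl⟩
    exact ⟨h ≫ pbSnd x P.arr, hom_ext fun z => (Subtype.prop (Hom.fn h z)).symm⟩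
  · rintro ⟨h, hh⟩
    obtain ⟨l, hl, -⟩ := exists_pbLift v h hh.symm
    exact ⟨l, hl⟩

theorem sat_sub {C D V : 𝔄.UFam} {P : Siev (prod C D)} {s : W ⟶ C} {t : W ⟶ D} {v : V ⟶ W} :
    (P.sub s t).Sat v ↔ P.Sat (pair (v ≫ s) (v ≫ t)) := sat_reindex

theorem sat_inf {P Q : Siev X} {x : W ⟶ X} : (inf P Q).Sat x ↔ P.Sat x ∧ Q.Sat x := by
  constructor
  · rintro ⟨h, rfl⟩
    exact ⟨⟨h ≫ pbFst P.arr Q.arr, Category.assoc _ _ _⟩, ⟨h ≫ pbSnd P.arr Q.arr,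
      hom_ext fun z => (Subtype.prop (Hom.fn h z)).symm⟩⟩
  · rintro ⟨⟨h, rfl⟩, ⟨k, hk⟩⟩
    obtain ⟨l, hl, -⟩ := exists_pbLift h k hk.symm
    exact ⟨l, by simp only [inf]; rw [← Category.assoc, hl]⟩

end Siev

/-! ### The category `Set{𝔄}` -/

open UFam

/-- Objects of `Set{𝔄}`: total equivalence relations in the fibration of sieves on `ufam 𝔄`.
Judgments are required for all terms in all contexts `W`, equivalently for the generic ones. -/
structure SetPsh (𝔄 : UniformPreorder.{u}) [FinitelyComplete 𝔄] where
  /-- the underlying object -/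
  obj : 𝔄.UFam
  /-- the equivalence relation `ρ` -/
  rel : Siev (prod obj obj)
  /-- `⊢ ρ(c, c)` -/
  total : ∀ (W : 𝔄.UFam) (c : W ⟶ obj), Siev.tt W ≤ rel.sub c c
  /-- `ρ(c, d) ⊢ ρ(d, c)` -/
  symm : ∀ (W : 𝔄.UFam) (c d : W ⟶ obj), rel.sub c d ≤ rel.sub d c
  /-- `ρ(c, d), ρ(d, e) ⊢ ρ(c, e)` -/
  trans : ∀ (W : 𝔄.UFam) (c d e : W ⟶ obj),
    Siev.inf (rel.sub c d) (rel.sub d e) ≤ rel.sub c e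

namespace SetPsh

variable {𝔄 : UniformPreorder.{u}} [FinitelyComplete 𝔄]

/-- Functional relations between equivalence relations in the fibration of sieves. -/
structure FunRel (X Y : 𝔄.SetPsh) where
  /-- the binary predicate `φ` -/
  rel : Siev (prod X.obj Y.obj)
  /-- `φ(c, d) ⊢ ρ(c, c) ∧ σ(d, d)` -/
  strict : ∀ (W : 𝔄.UFam) (c : W ⟶ X.obj) (d : W ⟶ Y.obj),
    rel.sub c d ≤ Siev.inf (X.rel.sub c c) (Y.rel.sub d d)
  /-- `φ(c, d), ρ(c, c'), σ(d, d') ⊢ φ(c', d')` -/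
  cong : ∀ (W : 𝔄.UFam) (c c' : W ⟶ X.obj) (d d' : W ⟶ Y.obj),
    Siev.inf (rel.sub c d) (Siev.inf (X.rel.sub c c') (Y.rel.sub d d')) ≤ rel.sub c' d'
  /-- `φ(c, d), φ(c, d') ⊢ σ(d, d')` -/
  singval : ∀ (W : 𝔄.UFam) (c : W ⟶ X.obj) (d d' : W ⟶ Y.obj),
    Siev.inf (rel.sub c d) (rel.sub c d') ≤ Y.rel.sub d d'
  /-- `ρ(c, c) ⊢ ∃ d, φ(c, d)` -/
  tot : ∀ (W : 𝔄.UFam) (c : W ⟶ X.obj),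
    X.rel.sub c c ≤ Siev.ex (fst W Y.obj) (rel.sub (fst W Y.obj ≫ c) (snd W Y.obj))

/-- Functional relations are identified if they are logically equivalent. -/
instance (X Y : 𝔄.SetPsh) : Setoid (FunRel X Y) where
  r φ ψ := φ.rel ≤ ψ.rel ∧ ψ.rel ≤ φ.rel
  iseqv := ⟨fun _ => ⟨le_refl _, le_refl _⟩, fun h => ⟨h.2, h.1⟩,
    fun h k => ⟨h.1.trans k.1, k.2.trans h.2⟩⟩

section Sat

variable {W : 𝔄.UFam}

theorem sat_refl (X : 𝔄.SetPsh) (c : W ⟶ X.obj) : X.rel.Sat (pair c c) := by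
  have h := Siev.le_iff_sat.1 (X.total W c) W (𝟙 W) (Siev.sat_tt _)
  simpa using Siev.sat_sub.1 h

theorem sat_symm (X : 𝔄.SetPsh) {c d : W ⟶ X.obj} (h : X.rel.Sat (pair c d)) :
    X.rel.Sat (pair d c) := by
  have h := Siev.le_iff_sat.1 (X.symm W c d) W (𝟙 W) (Siev.sat_sub.2 (by simpa using h))
  simpa using Siev.sat_sub.1 h

theorem sat_trans (X : 𝔄.SetPsh) {c d e : W ⟶ X.obj} (h : X.rel.Sat (pair c d))
    (h' : X.rel.Sat (pair d e)) : X.rel.Sat (pair c e) := by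
  have h := Siev.le_iff_sat.1 (X.trans W c d e) W (𝟙 W)
    (Siev.sat_inf.2 ⟨Siev.sat_sub.2 (by simpa using h), Siev.sat_sub.2 (by simpa using h')⟩)
  simpa using Siev.sat_sub.1 h

variable {X Y : 𝔄.SetPsh} (φ : FunRel X Y)

theorem FunRel.sat_cong {c c' : W ⟶ X.obj} {d d' : W ⟶ Y.obj} (h : φ.rel.Sat (pair c d))
    (hc : X.rel.Sat (pair c c')) (hd : Y.rel.Sat (pair d d')) : φ.rel.Sat (pair c' d') := by
  have h := Siev.le_iff_sat.1 (φ.cong W c c' d d') W (𝟙 W)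
    (Siev.sat_inf.2 ⟨Siev.sat_sub.2 (by simpa using h),
      Siev.sat_inf.2 ⟨Siev.sat_sub.2 (by simpa using hc), Siev.sat_sub.2 (by simpa using hd)⟩⟩)
  simpa using Siev.sat_sub.1 h

theorem FunRel.sat_singval {c : W ⟶ X.obj} {d d' : W ⟶ Y.obj} (h : φ.rel.Sat (pair c d))
    (h' : φ.rel.Sat (pair c d')) : Y.rel.Sat (pair d d') := by
  have h := Siev.le_iff_sat.1 (φ.singval W c d d') W (𝟙 W)
    (Siev.sat_inf.2 ⟨Siev.sat_sub.2 (by simpa using h), Siev.sat_sub.2 (by simpa using h')⟩)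
  simpa using Siev.sat_sub.1 h

theorem FunRel.sat_tot (c : W ⟶ X.obj) : ∃ d : W ⟶ Y.obj, φ.rel.Sat (pair c d) := by
  have h := Siev.le_iff_sat.1 (φ.tot W c) W (𝟙 W)
    (Siev.sat_sub.2 (by simpa using sat_refl X c))
  obtain ⟨x, hx, hxW⟩ := Siev.sat_ex.1 h
  have hx := Siev.sat_sub.1 hx
  rw [← Category.assoc, hxW, Category.id_comp] at hx
  exact ⟨_, hx⟩

/-- A functional relation from the judgments in terms of generalized elements. -/
def FunRel.mk' (P : Siev (prod X.obj Y.obj))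
    (cong : ∀ (W : 𝔄.UFam) (c c' : W ⟶ X.obj) (d d' : W ⟶ Y.obj), P.Sat (pair c d) →
      X.rel.Sat (pair c c') → Y.rel.Sat (pair d d') → P.Sat (pair c' d'))
    (singval : ∀ (W : 𝔄.UFam) (c : W ⟶ X.obj) (d d' : W ⟶ Y.obj), P.Sat (pair c d) →
      P.Sat (pair c d') → Y.rel.Sat (pair d d'))
    (tot : ∀ (W : 𝔄.UFam) (c : W ⟶ X.obj), ∃ d : W ⟶ Y.obj, P.Sat (pair c d)) :
    FunRel X Y where
  rel := P
  strict W c d := Siev.le_iff_sat.2 fun V v _ =>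
    Siev.sat_inf.2 ⟨Siev.sat_sub.2 (sat_refl X _), Siev.sat_sub.2 (sat_refl Y _)⟩
  cong W c c' d d' := Siev.le_iff_sat.2 fun V v h => by
    simp only [Siev.sat_inf, Siev.sat_sub] at h ⊢
    exact cong V _ _ _ _ h.1 h.2.1 h.2.2
  singval W c d d' := Siev.le_iff_sat.2 fun V v h => by
    simp only [Siev.sat_inf, Siev.sat_sub] at h ⊢
    exact singval V _ _ _ h.1 h.2
  tot W c := Siev.le_iff_sat.2 fun V v _ => by
    obtain ⟨d, hd⟩ := tot V (v ≫ c)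
    exact Siev.sat_ex.2 ⟨pair v d, Siev.sat_sub.2 hd, rfl⟩

end Sat

variable {X Y Z : 𝔄.SetPsh}

/-- The relational composite `∃ d, φ(c, d) ∧ γ(d, e)`. -/
def compRel {A B C : 𝔄.UFam} (P : Siev (prod A B)) (Q : Siev (prod B C)) : Siev (prod A C) :=
  Siev.ex (fst (prod A C) B)
    (Siev.inf (P.sub (fst (prod A C) B ≫ fst A C) (snd (prod A C) B))
      (Q.sub (snd (prod A C) B) (fst (prod A C) B ≫ snd A C)))

theorem sat_compRel {A B C W : 𝔄.UFam} {P : Siev (prod A B)} {Q : Siev (prod B C)}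
    {a : W ⟶ A} {c : W ⟶ C} : (compRel P Q).Sat (pair a c) ↔
      ∃ b : W ⟶ B, P.Sat (pair a b) ∧ Q.Sat (pair b c) := by
  simp only [compRel, Siev.sat_ex, Siev.sat_inf, Siev.sat_sub]
  constructor
  · rintro ⟨x, ⟨h₁, h₂⟩, hx⟩
    rw [← Category.assoc, hx] at h₁ h₂
    exact ⟨_, h₁, h₂⟩
  · rintro ⟨b, h₁, h₂⟩
    exact ⟨pair (pair a c) b, ⟨h₁, h₂⟩, rfl⟩

/-- Composition of functional relations. -/
def FunRel.comp (φ : FunRel X Y) (γ : FunRel Y Z) : FunRel X Z :=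
  FunRel.mk' (compRel φ.rel γ.rel)
    (by
      intro W c c' d d' h hc hd
      obtain ⟨y, h₁, h₂⟩ := sat_compRel.1 h
      exact sat_compRel.2 ⟨y, φ.sat_cong h₁ hc (sat_refl Y y), γ.sat_cong h₂ (sat_refl Y y) hd⟩)
    (by
      intro W c d d' h h'
      obtain ⟨y, h₁, h₂⟩ := sat_compRel.1 h
      obtain ⟨y', h₁', h₂'⟩ := sat_compRel.1 h'
      have hy := φ.sat_singval h₁ h₁'
      exact γ.sat_singval (γ.sat_cong h₂ hy (sat_refl Z d)) h₂')
    (by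
      intro W c
      obtain ⟨y, hy⟩ := φ.sat_tot c
      obtain ⟨z, hz⟩ := γ.sat_tot y
      exact ⟨z, sat_compRel.2 ⟨y, hy, hz⟩⟩)

/-- The identity functional relation is the equivalence relation itself. -/
def FunRel.id (X : 𝔄.SetPsh) : FunRel X X :=
  FunRel.mk' X.rel
    (fun _ _ _ _ _ h hc hd => sat_trans X (sat_trans X (sat_symm X hc) h) hd)
    (fun _ _ _ _ h h' => sat_trans X (sat_symm X h) h')
    (fun _ c => ⟨c, sat_refl X c⟩)

theorem FunRel.equiv_iff {φ ψ : FunRel X Y} : φ ≈ ψ ↔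
    ∀ (W : 𝔄.UFam) (c : W ⟶ X.obj) (d : W ⟶ Y.obj),
      φ.rel.Sat (pair c d) ↔ ψ.rel.Sat (pair c d) := by
  change (φ.rel ≤ ψ.rel ∧ ψ.rel ≤ φ.rel) ↔ _
  rw [Siev.le_iff_sat, Siev.le_iff_sat]
  constructor
  · exact fun h W c d => ⟨h.1 W _, h.2 W _⟩
  · exact fun h => ⟨fun W x hx => (h W (x ≫ fst _ _) (x ≫ snd _ _)).1 hx,
      fun W x hx => (h W (x ≫ fst _ _) (x ≫ snd _ _)).2 hx⟩

/-- The category `Set{𝔄}` of equivalence relations and (classes of) functional relations in the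
fibration of sieves on `ufam 𝔄`. -/
instance : Category 𝔄.SetPsh where
  Hom X Y := Quotient (inferInstance : Setoid (FunRel X Y))
  id X := ⟦FunRel.id X⟧
  comp f g := Quotient.map₂ FunRel.comp (by
    intro φ φ' h γ γ' h'
    rw [FunRel.equiv_iff] at h h' ⊢
    intro W c d
    refine sat_compRel.trans (Iff.trans ?_ sat_compRel.symm)
    simp only [h, h']) f g
  id_comp := by
    rintro X Y ⟨φ⟩
    refine Quotient.sound (FunRel.equiv_iff.2 fun W c d => sat_compRel.trans ?_)
    exact ⟨fun ⟨b, h₁, h₂⟩ => φ.sat_cong h₂ (sat_symm X h₁) (sat_refl Y d),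
      fun h => ⟨c, sat_refl X c, h⟩⟩
  comp_id := by
    rintro X Y ⟨φ⟩
    refine Quotient.sound (FunRel.equiv_iff.2 fun W c d => sat_compRel.trans ?_)
    exact ⟨fun ⟨b, h₁, h₂⟩ => φ.sat_cong h₁ (sat_refl X c) h₂,
      fun h => ⟨d, h, sat_refl Y d⟩⟩
  assoc := by
    rintro X Y Z T ⟨φ⟩ ⟨γ⟩ ⟨θ⟩
    refine Quotient.sound (FunRel.equiv_iff.2 fun W c d => ?_)
    refine sat_compRel.trans (Iff.trans ?_ sat_compRel.symm)
    constructor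
    · rintro ⟨b, h, h₃⟩
      obtain ⟨a, h₁, h₂⟩ := sat_compRel.1 h
      exact ⟨a, h₁, sat_compRel.2 ⟨b, h₂, h₃⟩⟩
    · rintro ⟨a, h₁, h⟩
      obtain ⟨b, h₂, h₃⟩ := sat_compRel.1 h
      exact ⟨b, sat_compRel.2 ⟨a, h₁, h₂⟩, h₃⟩

end SetPsh

end UniformPreorder

/-- A category is locally cartesian closed if all its slices are cartesian closed, i.e. have finite
products and exponentials. -/
def IsLocallyCartesianClosed (C : Type*) [Category C] : Prop :=
  ∀ X : C, ∃ _ : CartesianMonoidalCategory (Over X), Nonempty (MonoidalClosed (Over X))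

namespace UniformPreorder

open FinitelyComplete

/-! ### Uniqueness of implications and universal quantifications up to equivalence. -/

namespace Pred

variable {𝔅 : UniformPreorder.{u}} {M N : Type u}

/-! Relational completeness provides codes `h` for the relations `r(a ∧ -, -)`, chosen uniformly in
`a` and decoded by a single distinguished relation `@`; decoding may yield a larger relation, which
is harmless because realizability only asks for some related element.

1 ⇒ 2: the codes carrying every element of `φ m` to some element of `ψ m` form the implication at
`m` (`D.isImp_mk`). Universal quantification is the same construction with the dummy argument sort
`one` (`D.isAll_mk`). These formulas are stable under substitution, and uniqueness of adjoints
transfers stability to any other choice.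

2 ⇒ 1: over the set of all relations `S` from `A j` to `A k`, the predicate "for all `(b, c)` in
`S`, `{b}` implies `{c}`" collects the codes of `S`. Its counit is `@`, and its universal property
at the family `S = r(a ∧ -, -)` yields the coding relation.

3 ⇒ 1: the same generic family is read as an exponential in a slice over a discrete object. The
realizer of evaluation is `@`, and the realizer of a transpose is the coding relation.

1 ⇒ 3: by choice, cover-cartesian maps split, so entailment of sieves is plain factorization and
every functional relation is tracked by a morphism (`exists_hom_eq`). Thus `Set{𝔄}` consists of
pseudo-equivalence relations in `UFam 𝔄` and compatible morphisms modulo equivalence. For such a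
category weak dependent products in `UFam 𝔄` suffice (`exists_weakPi`). They yield universal
quantification of sieves and weak function objects; restricting these to the functions respecting
equivalence, and identifying pointwise equivalent ones, makes the exponentials strict. -/

theorem IsImp.of_equiv [FinitelyComplete 𝔅] {φ ψ χ χ' : 𝔅.Pred M} (h : IsImp φ ψ χ) (h₁ : χ ≤ χ')
    (h₂ : χ' ≤ χ) : IsImp φ ψ χ' :=
  fun ξ => ⟨fun hξ => (h ξ).1 (hξ.trans h₂), fun hξ => ((h ξ).2 hξ).trans h₁⟩

theorem IsImp.le [FinitelyComplete 𝔅] {φ ψ χ χ' : 𝔅.Pred M} (h : IsImp φ ψ χ)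
    (h' : IsImp φ ψ χ') : χ ≤ χ' :=
  (h' χ).2 ((h χ).1 le_rfl)

theorem IsAll.of_equiv {u : N → M} {φ : 𝔅.Pred N} {χ χ' : 𝔅.Pred M} (h : IsAll u φ χ)
    (h₁ : χ ≤ χ') (h₂ : χ' ≤ χ) : IsAll u φ χ' :=
  fun ξ => ⟨fun hξ => (h ξ).1 (hξ.trans h₂), fun hξ => ((h ξ).2 hξ).trans h₁⟩

theorem IsAll.le {u : N → M} {φ : 𝔅.Pred N} {χ χ' : 𝔅.Pred M} (h : IsAll u φ χ)
    (h' : IsAll u φ χ') : χ ≤ χ' :=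
  (h' χ).2 ((h χ).1 le_rfl)

end Pred

variable {𝔄 : UniformPreorder.{u}}

/-! ### Explicit implication and universal quantification in `D 𝔄`. -/

namespace D

/-- A predicate on `M` for the uniform preorder `D 𝔄`. -/
def mk {M : Type u} (i : 𝔄.Idx) (φ : M → Set (𝔄.Car i)) : (D 𝔄).Pred M := ⟨i, φ⟩

theorem eq_mk {M : Type u} (φ : (D 𝔄).Pred M) :
    ∃ (i : 𝔄.Idx) (f : M → Set (𝔄.Car i)), φ = mk i f :=
  ⟨φ.idx, φ.fn, rfl⟩

theorem mk_le_mk {M : Type u} {i j : 𝔄.Idx} {φ : M → Set (𝔄.Car i)} {ψ : M → Set (𝔄.Car j)} :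
    mk i φ ≤ mk j ψ ↔ ∃ r ∈ 𝔄.Rel i j, ∀ m, ∀ a ∈ φ m, ∃ b ∈ ψ m, r a b := by
  constructor
  · rintro ⟨r, hr, h⟩
    exact ⟨r, hr, fun m => h _ _ ⟨m, rfl, rfl⟩⟩
  · rintro ⟨r, hr, h⟩
    exact ⟨r, hr, by rintro _ _ ⟨m, rfl, rfl⟩; exact h m⟩

theorem inf_mk [FinitelyComplete 𝔄] {M : Type u} {i j : 𝔄.Idx} (φ : M → Set (𝔄.Car i))
    (ψ : M → Set (𝔄.Car j)) : Pred.inf (mk i φ) (mk j ψ) =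
      mk (star i j) fun m => {x | ∃ a ∈ φ m, ∃ b ∈ ψ m, x = meet a b} := rfl

variable [FinitelyComplete 𝔄]

/-- One direction composes a realizer with `ev`. In the other, a realizer `r` of the conjunction is
curried: the code of `r(a ∧ -, -)` lies in the implication because `ev` decodes it to at least that
relation. -/
theorem isImp_mk {j k e : 𝔄.Idx} {ev : 𝔄.Car (star e j) → 𝔄.Car k → Prop}
    (hev : ev ∈ 𝔄.Rel (star e j) k)
    (H : ∀ (i : 𝔄.Idx) (r : 𝔄.Car (star i j) → 𝔄.Car k → Prop), r ∈ 𝔄.Rel (star i j) k →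
      ∃ r' : 𝔄.Car i → 𝔄.Car e → Prop, r' ∈ 𝔄.Rel i e ∧
        ∀ a : 𝔄.Car i, ∃ h : 𝔄.Car e, r' a h ∧
          ∀ (b : 𝔄.Car j) (c : 𝔄.Car k), r (meet a b) c → ev (meet h b) c)
    {M : Type u} (φ : M → Set (𝔄.Car j)) (ψ : M → Set (𝔄.Car k)) :
    Pred.IsImp (mk j φ) (mk k ψ) (mk e fun m => {h | ∀ b ∈ φ m, ∃ c ∈ ψ m, ev (meet h b) c}) := by
  intro ξ
  obtain ⟨i, ξ, rfl⟩ := eq_mk ξ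
  rw [inf_mk, mk_le_mk, mk_le_mk]
  constructor
  · rintro ⟨r, hr, h⟩
    refine ⟨_, 𝔄.comp_mem (meet_mono hr (𝔄.id_mem j)) hev, ?_⟩
    rintro m _ ⟨a, ha, b, hb, rfl⟩
    obtain ⟨g, hg, hag⟩ := h m a ha
    obtain ⟨c, hc, hgc⟩ := hg b hb
    exact ⟨c, hc, _, ⟨a, g, b, b, hag, rfl, rfl, rfl⟩, hgc⟩
  · rintro ⟨r, hr, h⟩
    obtain ⟨r', hr', h'⟩ := H i r hr
    refine ⟨r', hr', fun m a ha => ?_⟩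
    obtain ⟨g, hag, hg⟩ := h' a
    refine ⟨g, fun b hb => ?_, hag⟩
    obtain ⟨c, hc, hrc⟩ := h m _ ⟨a, ha, b, hb, rfl⟩
    exact ⟨c, hc, hg b c hrc⟩

/-- One code must serve the whole fiber of `u`. This is possible since it codes a relation, so the
`c` it is related to may vary with `x`. -/
theorem isAll_mk {k e : 𝔄.Idx} {ev : 𝔄.Car (star e (one : 𝔄.Idx)) → 𝔄.Car k → Prop}
    (hev : ev ∈ 𝔄.Rel (star e one) k)
    (H : ∀ (i : 𝔄.Idx) (r : 𝔄.Car (star i one) → 𝔄.Car k → Prop), r ∈ 𝔄.Rel (star i one) k →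
      ∃ r' : 𝔄.Car i → 𝔄.Car e → Prop, r' ∈ 𝔄.Rel i e ∧
        ∀ a : 𝔄.Car i, ∃ h : 𝔄.Car e, r' a h ∧
          ∀ (b : 𝔄.Car one) (c : 𝔄.Car k), r (meet a b) c → ev (meet h b) c)
    {X Y : Type u} (u : X → Y) (φ : X → Set (𝔄.Car k)) :
    Pred.IsAll u (mk k φ)
      (mk e fun y => {h | ∀ x, u x = y → ∃ c ∈ φ x, ev (meet h top) c}) := by
  intro ξ
  obtain ⟨i, ξ, rfl⟩ := eq_mk ξ
  change mk (𝔄 := 𝔄) i ξ ≤ _ ↔ mk (𝔄 := 𝔄) i (fun x => ξ (u x)) ≤ _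
  rw [mk_le_mk, mk_le_mk]
  constructor
  · rintro ⟨r, hr, h⟩
    refine ⟨_, 𝔄.comp_mem (meet_diag i) (𝔄.comp_mem (meet_mono hr (le_top i)) hev),
      fun x a ha => ?_⟩
    obtain ⟨g, hg, hag⟩ := h _ a ha
    obtain ⟨c, hc, hgc⟩ := hg x rfl
    exact ⟨c, hc, _, rfl, _, ⟨a, g, a, _, hag, rfl, rfl, rfl⟩, hgc⟩
  · rintro ⟨r, hr, h⟩
    -- To be curried, `r` is given a dummy argument of sort `one`, discarded by the left projection.
    obtain ⟨r', hr', h'⟩ := H i _ (𝔄.comp_mem (meet_left i one) hr)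
    refine ⟨r', hr', fun y a ha => ?_⟩
    obtain ⟨g, hag, hg⟩ := h' a
    refine ⟨g, ?_, hag⟩
    rintro x rfl
    obtain ⟨c, hc, hrc⟩ := h x a ha
    exact ⟨c, hc, hg _ c ⟨a, ⟨a, _, rfl, rfl⟩, hrc⟩⟩

end D

/-! ### Relational completeness versus the logic of `D 𝔄`. -/

variable [FinitelyComplete 𝔄]

/-- The explicit implication is computed pointwise, so its reindexing is definitionally the explicit
implication of the reindexed predicates; any other implication is equivalent to it. -/
theorem RelationallyComplete.hasImplication (h : 𝔄.RelationallyComplete) :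
    (D 𝔄).HasImplication := by
  refine ⟨?_, ?_⟩
  · intro M φ ψ
    obtain ⟨j, φ, rfl⟩ := D.eq_mk φ
    obtain ⟨k, ψ, rfl⟩ := D.eq_mk ψ
    obtain ⟨e, ev, hev, H⟩ := h j k
    exact ⟨_, D.isImp_mk hev H φ ψ⟩
  · intro M N f φ ψ χ hχ
    obtain ⟨j, φ, rfl⟩ := D.eq_mk φ
    obtain ⟨k, ψ, rfl⟩ := D.eq_mk ψ
    obtain ⟨e, ev, hev, H⟩ := h j k
    have h₁ := D.isImp_mk hev H φ ψ
    have h₂ := D.isImp_mk hev H (fun n => φ (f n)) (fun n => ψ (f n))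
    exact h₂.of_equiv (Pred.reindex_mono f (h₁.le hχ)) (Pred.reindex_mono f (hχ.le h₁))

theorem RelationallyComplete.hasUniversalQuantification (h : 𝔄.RelationallyComplete) :
    (D 𝔄).HasUniversalQuantification := by
  refine ⟨?_, ?_⟩
  · intro X Y u φ
    obtain ⟨k, φ, rfl⟩ := D.eq_mk φ
    obtain ⟨e, ev, hev, H⟩ := h one k
    exact ⟨_, D.isAll_mk hev H u φ⟩
  · rintro P X Z Y p q u w ⟨hs, hp⟩ φ χ hχ
    obtain ⟨k, φ, rfl⟩ := D.eq_mk φ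
    obtain ⟨e, ev, hev, H⟩ := h one k
    have h₁ := D.isAll_mk hev H u φ
    have h₂ := D.isAll_mk hev H q (fun t => φ (p t))
    -- In a pullback square `p` maps the fiber of `q` over `z` onto the fiber of `u` over `w z`, so
    -- the two explicit formulas coincide.
    have key : D.mk e (fun z => {h | ∀ t, q t = z → ∃ c ∈ φ (p t), ev (meet h top) c}) =
        (D.mk e fun y => {h | ∀ x, u x = y → ∃ c ∈ φ x, ev (meet h top) c}).reindex w := by
      refine congrArg (D.mk e) (funext fun z => Set.ext fun g => ⟨fun hg x hx => ?_, ?_⟩)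
      · obtain ⟨t, ⟨rfl, ht⟩, -⟩ := hp x z hx
        exact hg t ht
      · rintro hg t rfl
        exact hg (p t) (hs t)
    rw [key] at h₂
    exact h₂.of_equiv (Pred.reindex_mono w (h₁.le hχ)) (Pred.reindex_mono w (hχ.le h₁))

theorem relationallyComplete_of_D (hI : (D 𝔄).HasImplication)
    (hU : (D 𝔄).HasUniversalQuantification) : 𝔄.RelationallyComplete := by
  intro j k
  -- `X` parametrizes all relations and `E` is the total space of their graphs; `χ S` below is the
  -- set of codes of `S`.
  let X : Type u := 𝔄.Car j → 𝔄.Car k → Prop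
  let E : Type u := {t : X × 𝔄.Car j × 𝔄.Car k // t.1 t.2.1 t.2.2}
  obtain ⟨χ₀, h₀⟩ := hI.1 E (D.mk j fun t => {t.1.2.1}) (D.mk k fun t => {t.1.2.2})
  obtain ⟨χ, hχ⟩ := hU.1 E X (fun t => t.1.1) χ₀
  obtain ⟨e, χ, rfl⟩ := D.eq_mk χ
  have key : ∀ (i : 𝔄.Idx) (ξ : X → Set (𝔄.Car i)), D.mk i ξ ≤ D.mk e χ ↔
      ∃ r ∈ 𝔄.Rel (star i j) k, ∀ (S : X) (b c), S b c → ∀ a ∈ ξ S, r (meet a b) c := by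
    intro i ξ
    rw [hχ, h₀]
    change Pred.inf (D.mk i fun t : E => ξ t.1.1) _ ≤ _ ↔ _
    rw [D.inf_mk, D.mk_le_mk]
    constructor
    · rintro ⟨r, hr, h⟩
      refine ⟨r, hr, fun S b c hS a ha => ?_⟩
      obtain ⟨_, rfl, hc⟩ := h ⟨(S, b, c), hS⟩ _ ⟨a, ha, b, rfl, rfl⟩
      exact hc
    · rintro ⟨r, hr, h⟩
      refine ⟨r, hr, ?_⟩
      rintro ⟨⟨S, b, c⟩, hS⟩ _ ⟨a, ha, _, rfl, rfl⟩
      exact ⟨c, rfl, h S _ c hS a ha⟩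
  obtain ⟨ev, hev, hE⟩ := (key e χ).1 le_rfl
  refine ⟨e, ev, hev, fun i r hr => ?_⟩
  -- The predicate on `X` holds at `S` exactly those `a` with `S = r(a ∧ -, -)`, so `r` itself
  -- realizes the hypothesis of `key`.
  obtain ⟨r', hr', h'⟩ := D.mk_le_mk.1 ((key i fun S => {a | S = fun (b : 𝔄.Car j) c => r (meet a b) c}).2
    ⟨r, hr, by rintro _ _ _ hS a rfl; exact hS⟩)
  refine ⟨r', hr', fun a => ?_⟩
  obtain ⟨g, hg, hag⟩ := h' _ a rfl
  exact ⟨g, hag, fun b c hr => hE _ b c hr g hg⟩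

end UniformPreorder

open Limits MonoidalCategory CartesianMonoidalCategory in
/-- A category with pullbacks is locally cartesian closed as soon as its slices have exponentials,
expressed by universal arrows with respect to arbitrary pullback squares. -/
theorem isLocallyCartesianClosed_of_exists_exponential {C : Type*} [Category C] [HasPullbacks C]
    (H : ∀ {X Y Z : C} (f : Y ⟶ X) (g : Z ⟶ X), ∃ (E : C) (π : E ⟶ X) (P : C) (p : P ⟶ Y)
      (q : P ⟶ E) (_ : IsPullback p q f π) (ev : P ⟶ Z), ev ≫ g = p ≫ f ∧
      ∀ (V : C) (v : V ⟶ X), ∃ (P' : C) (p' : P' ⟶ Y) (q' : P' ⟶ V) (_ : IsPullback p' q' f v),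
        ∀ k : P' ⟶ Z, k ≫ g = p' ≫ f → ∃! l : V ⟶ E, l ≫ π = v ∧
          ∀ n : P' ⟶ P, n ≫ p = p' → n ≫ q = q' ≫ l → n ≫ ev = k) :
    IsLocallyCartesianClosed C := by
  intro X
  let _ := Over.cartesianMonoidalCategory X
  refine ⟨inferInstance, ⟨⟨fun A => ?_⟩⟩⟩
  suffices h : (tensorLeft A).IsLeftAdjoint from
    ⟨_, Adjunction.ofIsLeftAdjoint (tensorLeft A)⟩
  -- A right adjoint exists once every `Z` admits a universal arrow from the functor `A ⊗ -`.
  suffices h : ∀ Z : Over X, HasTerminal (CostructuredArrow (tensorLeft A) Z) from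
    isLeftAdjoint_of_costructuredArrowTerminals _
  intro Z
  obtain ⟨E, π, P, p, q, hP, ev, hev, hu⟩ := H A.hom Z.hom
  have key : ∀ T : Over X, pullback.fst A.hom T.hom ≫ A.hom = pullback.snd A.hom T.hom ≫ T.hom :=
    fun T => pullback.condition
  let φ : (A ⊗ Over.mk π).left ⟶ P :=
    hP.lift (pullback.fst A.hom (Over.mk π).hom) (pullback.snd A.hom (Over.mk π).hom) (key _)
  have hφp : φ ≫ p = pullback.fst A.hom (Over.mk π).hom := hP.lift_fst _ _ _
  have hφq : φ ≫ q = pullback.snd A.hom (Over.mk π).hom := hP.lift_snd _ _ _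
  let evO : A ⊗ Over.mk π ⟶ Z := Over.homMk (φ ≫ ev) (by
    rw [Category.assoc, hev, ← Category.assoc, hφp]; rfl)
  suffices h : ∀ T : CostructuredArrow (tensorLeft A) Z,
      ∃! l : T.left ⟶ Over.mk π, A ◁ l ≫ evO = T.hom by
    refine (IsTerminal.ofUniqueHom (Y := CostructuredArrow.mk (S := tensorLeft A) evO)
      (fun T => CostructuredArrow.homMk (h T).choose (h T).choose_spec.1) fun T m => ?_).hasTerminal
    exact CostructuredArrow.hom_ext _ _
      ((h T).choose_spec.2 m.left (CostructuredArrow.w m))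
  intro T
  obtain ⟨P', p', q', hP', hk⟩ := hu T.left.left T.left.hom
  let ψ : P' ⟶ (A ⊗ T.left).left := pullback.lift p' q' hP'.w
  let χ : (A ⊗ T.left).left ⟶ P' :=
    hP'.lift (pullback.fst A.hom T.left.hom) (pullback.snd A.hom T.left.hom) (key _)
  have hχψ : χ ≫ ψ = 𝟙 _ := by
    apply Over.tensorObj_ext
    · rw [Category.assoc, pullback.lift_fst, hP'.lift_fst, Category.id_comp]
    · rw [Category.assoc, pullback.lift_snd, hP'.lift_snd, Category.id_comp]
  have hw : T.hom.left ≫ Z.hom = pullback.fst A.hom T.left.hom ≫ A.hom := Over.w T.hom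
  -- `ψ` and `φ` pass between the chosen products and the given pullbacks, so this composite is the
  -- map induced by `l` over which the universal property quantifies.
  have aux : ∀ (l : T.left ⟶ Over.mk π), (ψ ≫ (A ◁ l).left ≫ φ) ≫ p = p' ∧
      (ψ ≫ (A ◁ l).left ≫ φ) ≫ q = q' ≫ l.left := by
    intro l
    constructor
    · rw [Category.assoc, Category.assoc, hφp, Over.whiskerLeft_left_fst, pullback.lift_fst]
    · rw [Category.assoc, Category.assoc, hφq, Over.whiskerLeft_left_snd,
        pullback.lift_snd_assoc]
  obtain ⟨l, ⟨hl, hl'⟩, hlu⟩ := hk (ψ ≫ T.hom.left) (by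
    rw [Category.assoc, hw, pullback.lift_fst_assoc])
  refine ⟨Over.homMk l hl, ?_, fun m hm => ?_⟩
  · have h := hl' _ (aux (Over.homMk l hl)).1 (aux (Over.homMk l hl)).2
    have h := congrArg (χ ≫ ·) h
    simp only [← Category.assoc, hχψ] at h
    simp only [Category.id_comp, Category.assoc] at h
    exact Over.OverMorphism.ext h
  · refine Over.OverMorphism.ext (hlu _ ⟨Over.w m, fun n h₁ h₂ => ?_⟩)
    have hn : n = ψ ≫ (A ◁ m).left ≫ φ :=
      hP.hom_ext (h₁.trans (aux m).1.symm) (h₂.trans (aux m).2.symm)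
    rw [hn, ← hm, Category.assoc, Category.assoc]
    rfl

/-- A square is a pullback if it has existence and uniqueness of lifts. -/
theorem isPullback_of_exists_lift {C : Type*} [Category C] {P X Y Z : C} {p : P ⟶ X} {q : P ⟶ Y}
    {f : X ⟶ Z} {g : Y ⟶ Z} (w : p ≫ f = q ≫ g)
    (ex : ∀ (T : C) (a : T ⟶ X) (b : T ⟶ Y), a ≫ f = b ≫ g → ∃ l : T ⟶ P, l ≫ p = a ∧ l ≫ q = b)
    (uniq : ∀ (T : C) (l l' : T ⟶ P), l ≫ p = l' ≫ p → l ≫ q = l' ≫ q → l = l') :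
    IsPullback p q f g := by
  refine ⟨⟨w⟩, ⟨Limits.PullbackCone.IsLimit.mk w
    (fun s => (ex _ s.fst s.snd s.condition).choose)
    (fun s => (ex _ s.fst s.snd s.condition).choose_spec.1)
    (fun s => (ex _ s.fst s.snd s.condition).choose_spec.2) fun s m h₁ h₂ => ?_⟩⟩
  have h := (ex _ s.fst s.snd s.condition).choose_spec
  exact uniq _ _ _ (h₁.trans h.1.symm) (h₂.trans h.2.symm)

/-! ### `Set{𝔄}` in terms of tracking morphisms. -/

namespace UniformPreorder

open FinitelyComplete UFam

variable {𝔄 : UniformPreorder.{u}} [FinitelyComplete 𝔄]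

theorem Siev.Sat.exists_lift {V A B : 𝔄.UFam} {P : Siev (prod A B)} {a : V ⟶ A} {b : V ⟶ B}
    (h : P.Sat (pair a b)) :
    ∃ l : V ⟶ P.dom, l ≫ P.arr ≫ fst A B = a ∧ l ≫ P.arr ≫ snd A B = b := by
  obtain ⟨l, hl⟩ := h
  refine ⟨l, ?_, ?_⟩
  · rw [← Category.assoc, hl, pair_fst]
  · rw [← Category.assoc, hl, pair_snd]

namespace SetPsh

variable {V W : 𝔄.UFam} {X Y Z : 𝔄.SetPsh}

/-- Two generalized elements are identified by the equivalence relation. -/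
def Eqv (X : 𝔄.SetPsh) (c d : W ⟶ X.obj) : Prop := X.rel.Sat (pair c d)

theorem Eqv.refl (X : 𝔄.SetPsh) (c : W ⟶ X.obj) : X.Eqv c c := sat_refl X c

theorem Eqv.of_eq {c d : W ⟶ X.obj} (h : c = d) : X.Eqv c d := h ▸ Eqv.refl X c

theorem Eqv.symm {c d : W ⟶ X.obj} (h : X.Eqv c d) : X.Eqv d c := sat_symm X h

theorem Eqv.trans {c d e : W ⟶ X.obj} (h : X.Eqv c d) (h' : X.Eqv d e) : X.Eqv c e :=
  sat_trans X h h'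

theorem Eqv.comp {c d : W ⟶ X.obj} (h : X.Eqv c d) (v : V ⟶ W) : X.Eqv (v ≫ c) (v ≫ d) :=
  Siev.Sat.comp h v

/-- An object of `Set{𝔄}` from an equivalence relation on generalized elements. -/
def ofSat (C : 𝔄.UFam) (S : Siev (prod C C))
    (refl : ∀ (W : 𝔄.UFam) (c : W ⟶ C), S.Sat (pair c c))
    (symm : ∀ (W : 𝔄.UFam) (c d : W ⟶ C), S.Sat (pair c d) → S.Sat (pair d c))
    (trans : ∀ (W : 𝔄.UFam) (c d e : W ⟶ C), S.Sat (pair c d) → S.Sat (pair d e) →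
      S.Sat (pair c e)) : 𝔄.SetPsh where
  obj := C
  rel := S
  total W c := Siev.le_iff_sat.2 fun V v _ => Siev.sat_sub.2 (refl V _)
  symm W c d := Siev.le_iff_sat.2 fun V v h => Siev.sat_sub.2 (symm V _ _ (Siev.sat_sub.1 h))
  trans W c d e := Siev.le_iff_sat.2 fun V v h => by
    simp only [Siev.sat_inf, Siev.sat_sub] at h ⊢
    exact trans V _ _ _ h.1 h.2

/-- A morphism of underlying objects respects the equivalence relations. -/
def Compat (X Y : 𝔄.SetPsh) (f : X.obj ⟶ Y.obj) : Prop :=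
  ∀ ⦃W : 𝔄.UFam⦄ ⦃c d : W ⟶ X.obj⦄, X.Eqv c d → Y.Eqv (c ≫ f) (d ≫ f)

theorem Compat.comp {f : X.obj ⟶ Y.obj} {g : Y.obj ⟶ Z.obj} (hf : Compat X Y f)
    (hg : Compat Y Z g) : Compat X Z (f ≫ g) := fun W c d h => by
  simpa only [Category.assoc] using hg (hf h)

theorem graph_sat (f : X.obj ⟶ Y.obj) {c : W ⟶ X.obj} {d : W ⟶ Y.obj} :
    (Y.rel.sub (fst X.obj Y.obj ≫ f) (snd X.obj Y.obj)).Sat (pair c d) ↔ Y.Eqv (c ≫ f) d :=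
  Siev.sat_sub

/-- The functional relation tracked by a compatible morphism. -/
def graph (f : X.obj ⟶ Y.obj) (hf : Compat X Y f) : FunRel X Y :=
  FunRel.mk' (Y.rel.sub (fst X.obj Y.obj ≫ f) (snd X.obj Y.obj))
    (fun _ _ _ _ _ h hc hd => (graph_sat f).2
      (((hf hc).symm.trans ((graph_sat f).1 h)).trans hd))
    (fun _ _ _ _ h h' => Eqv.trans (Eqv.symm ((graph_sat f).1 h)) ((graph_sat f).1 h'))
    (fun _ c => ⟨c ≫ f, (graph_sat f).2 (Eqv.refl Y _)⟩)

/-- The morphism of `Set{𝔄}` tracked by a compatible morphism. -/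
def hom (f : X.obj ⟶ Y.obj) (hf : Compat X Y f) : X ⟶ Y := Quotient.mk _ (graph f hf)

/-- Totality at the generic element `𝟙 X.obj` has an actual witness `f`, because existence in the
fibration of sieves is witnessed without passing to a cover. Single-valuedness then forces the
relation to be the graph of `f`. -/
theorem exists_hom_eq (φ : X ⟶ Y) : ∃ (f : X.obj ⟶ Y.obj) (hf : Compat X Y f), φ = hom f hf := by
  obtain ⟨φ⟩ := φ
  obtain ⟨f, hf⟩ := φ.sat_tot (𝟙 X.obj)
  have hf' : ∀ {W : 𝔄.UFam} (c : W ⟶ X.obj), φ.rel.Sat (pair c (c ≫ f)) := by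
    intro W c
    simpa using hf.comp c
  refine ⟨f, fun W c d h => ?_, Quotient.sound (FunRel.equiv_iff.2 fun W c d => ?_)⟩
  · exact φ.sat_singval (φ.sat_cong (hf' c) h (sat_refl Y _)) (hf' d)
  · refine Iff.trans ⟨fun h => φ.sat_singval (hf' c) h, fun h => ?_⟩ (graph_sat f).symm
    exact φ.sat_cong (hf' c) (sat_refl X _) h

theorem hom_eq_hom_iff {f g : X.obj ⟶ Y.obj} {hf : Compat X Y f} {hg : Compat X Y g} :
    hom f hf = hom g hg ↔ Y.Eqv f g := by
  constructor
  · intro h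
    have h := (FunRel.equiv_iff.1 (Quotient.exact h) _ (𝟙 X.obj) g).2
      ((graph_sat g).2 (Eqv.of_eq (Category.id_comp g)))
    simpa using (graph_sat f).1 h
  · refine fun h => Quotient.sound (FunRel.equiv_iff.2 fun W c d => ?_)
    refine (graph_sat f).trans (Iff.trans ?_ (graph_sat g).symm)
    exact ⟨fun k => (h.comp c).symm.trans k, fun k => (h.comp c).trans k⟩

theorem hom_comp_hom {f : X.obj ⟶ Y.obj} {g : Y.obj ⟶ Z.obj} (hf : Compat X Y f)
    (hg : Compat Y Z g) : hom f hf ≫ hom g hg = hom (f ≫ g) (hf.comp hg) := by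
  refine Quotient.sound (FunRel.equiv_iff.2 fun W c d => ?_)
  refine sat_compRel.trans (Iff.trans ?_ (graph_sat (f ≫ g)).symm)
  constructor
  · rintro ⟨b, h₁, h₂⟩
    have h₁ := hg ((graph_sat f).1 h₁)
    rw [Category.assoc] at h₁
    exact h₁.trans ((graph_sat g).1 h₂)
  · intro h
    refine ⟨c ≫ f, (graph_sat f).2 (Eqv.refl Y _), (graph_sat g).2 ?_⟩
    rwa [Category.assoc]

theorem hom_comp_hom_eq_hom_iff {f : X.obj ⟶ Y.obj} {g : Y.obj ⟶ Z.obj} {k : X.obj ⟶ Z.obj}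
    {hf : Compat X Y f} {hg : Compat Y Z g} {hk : Compat X Z k} :
    hom f hf ≫ hom g hg = hom k hk ↔ Z.Eqv (f ≫ g) k := by
  rw [hom_comp_hom, hom_eq_hom_iff]

theorem hom_comp_hom_eq_iff {T : 𝔄.SetPsh} {f : X.obj ⟶ Y.obj} {g : Y.obj ⟶ Z.obj}
    {f' : X.obj ⟶ T.obj} {g' : T.obj ⟶ Z.obj} {hf : Compat X Y f} {hg : Compat Y Z g}
    {hf' : Compat X T f'} {hg' : Compat T Z g'} :
    hom f hf ≫ hom g hg = hom f' hf' ≫ hom g' hg' ↔ Z.Eqv (f ≫ g) (f' ≫ g') := by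
  rw [hom_comp_hom, hom_comp_hom, hom_eq_hom_iff]

/-! ### Discrete objects -/

theorem diag_sat {C : 𝔄.UFam} {c d : W ⟶ C} :
    (⟨C, pair (𝟙 C) (𝟙 C)⟩ : Siev (prod C C)).Sat (pair c d) ↔ c = d := by
  constructor
  · rintro ⟨h, hh⟩
    have h₁ := congrArg (· ≫ fst C C) hh
    have h₂ := congrArg (· ≫ snd C C) hh
    exact h₁.symm.trans h₂
  · rintro rfl
    exact ⟨c, rfl⟩

/-- An object of `ufam 𝔄` with its equality relation. -/
def disc (C : 𝔄.UFam) : 𝔄.SetPsh :=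
  ofSat C ⟨C, pair (𝟙 C) (𝟙 C)⟩ (fun _ _ => diag_sat.2 rfl)
    (fun _ _ _ h => diag_sat.2 (diag_sat.1 h).symm)
    (fun _ _ _ _ h h' => diag_sat.2 ((diag_sat.1 h).trans (diag_sat.1 h')))

theorem disc_eqv {C : 𝔄.UFam} {c d : W ⟶ C} : (disc C).Eqv c d ↔ c = d := diag_sat

theorem compat_disc {C : 𝔄.UFam} (f : C ⟶ Y.obj) : Compat (disc C) Y f :=
  fun _ _ _ h => Eqv.of_eq (congrArg (· ≫ f) (disc_eqv.1 h))

/-! ### Pullbacks -/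

section Pullback

variable (f : Y.obj ⟶ X.obj) (g : Z.obj ⟶ X.obj)

/-- The predicate `f(y) ~ g(z)`. -/
def pbSiev : Siev (prod Y.obj Z.obj) := X.rel.sub (fst Y.obj Z.obj ≫ f) (snd Y.obj Z.obj ≫ g)

theorem pbSiev_sat {y : W ⟶ Y.obj} {z : W ⟶ Z.obj} :
    (pbSiev f g).Sat (pair y z) ↔ X.Eqv (y ≫ f) (z ≫ g) := Siev.sat_sub

theorem pbRel_sat {c d : W ⟶ (pbSiev f g).dom} :
    (Siev.inf (Y.rel.sub (fst _ _ ≫ (pbSiev f g).arr ≫ fst _ _)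
        (snd _ _ ≫ (pbSiev f g).arr ≫ fst _ _))
      (Z.rel.sub (fst _ _ ≫ (pbSiev f g).arr ≫ snd _ _)
        (snd _ _ ≫ (pbSiev f g).arr ≫ snd _ _))).Sat (pair c d) ↔
    Y.Eqv (c ≫ (pbSiev f g).arr ≫ fst _ _) (d ≫ (pbSiev f g).arr ≫ fst _ _) ∧
      Z.Eqv (c ≫ (pbSiev f g).arr ≫ snd _ _) (d ≫ (pbSiev f g).arr ≫ snd _ _) := by
  rw [Siev.sat_inf, Siev.sat_sub, Siev.sat_sub]
  rfl

/-- The pullback in `Set{𝔄}` of the morphisms tracked by `f` and `g`. -/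
def pbObj : 𝔄.SetPsh :=
  ofSat (pbSiev f g).dom _
    (fun _ _ => (pbRel_sat f g).2 ⟨Eqv.refl _ _, Eqv.refl _ _⟩)
    (fun _ _ _ h => (pbRel_sat f g).2 (((pbRel_sat f g).1 h).imp Eqv.symm Eqv.symm))
    (fun _ _ _ _ h h' => (pbRel_sat f g).2
      ⟨((pbRel_sat f g).1 h).1.trans ((pbRel_sat f g).1 h').1,
        ((pbRel_sat f g).1 h).2.trans ((pbRel_sat f g).1 h').2⟩)

/-- First projection on underlying objects. -/
def pbObjFst : (pbObj f g).obj ⟶ Y.obj := (pbSiev f g).arr ≫ fst Y.obj Z.obj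

/-- Second projection on underlying objects. -/
def pbObjSnd : (pbObj f g).obj ⟶ Z.obj := (pbSiev f g).arr ≫ snd Y.obj Z.obj

theorem pbObj_condition : X.Eqv (pbObjFst f g ≫ f) (pbObjSnd f g ≫ g) :=
  (pbSiev_sat f g).1 (pbSiev f g).sat_arr

/-- A generalized element of the underlying object is a pair together with a witness of its
equivalence over `X`, so the triangles commute strictly. The witness is not determined, hence
uniqueness holds only modulo `pbObj_eqv`, which ignores it. -/
theorem exists_pbObjLift {y : W ⟶ Y.obj} {z : W ⟶ Z.obj} (h : X.Eqv (y ≫ f) (z ≫ g)) :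
    ∃ l : W ⟶ (pbObj f g).obj, l ≫ pbObjFst f g = y ∧ l ≫ pbObjSnd f g = z :=
  ((pbSiev_sat f g).2 h).exists_lift

theorem pbObj_eqv {c d : W ⟶ (pbObj f g).obj} : (pbObj f g).Eqv c d ↔
    Y.Eqv (c ≫ pbObjFst f g) (d ≫ pbObjFst f g) ∧ Z.Eqv (c ≫ pbObjSnd f g) (d ≫ pbObjSnd f g) :=
  pbRel_sat f g

theorem compat_pbObjFst : Compat (pbObj f g) Y (pbObjFst f g) := fun _ _ _ h =>
  ((pbObj_eqv f g).1 h).1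

theorem compat_pbObjSnd : Compat (pbObj f g) Z (pbObjSnd f g) := fun _ _ _ h =>
  ((pbObj_eqv f g).1 h).2

theorem isPullback_pbObj (hf : Compat Y X f) (hg : Compat Z X g) :
    IsPullback (hom _ (compat_pbObjFst f g)) (hom _ (compat_pbObjSnd f g)) (hom f hf)
      (hom g hg) := by
  refine isPullback_of_exists_lift ?_ ?_ ?_
  · rw [hom_comp_hom, hom_comp_hom, hom_eq_hom_iff]
    exact pbObj_condition f g
  · intro T a b h
    obtain ⟨a, ha, rfl⟩ := exists_hom_eq a
    obtain ⟨b, hb, rfl⟩ := exists_hom_eq b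
    rw [hom_comp_hom, hom_comp_hom, hom_eq_hom_iff] at h
    obtain ⟨l, h₁, h₂⟩ := exists_pbObjLift f g h
    have hl : Compat T (pbObj f g) l := by
      intro W c d hcd
      refine (pbObj_eqv f g).2 ⟨?_, ?_⟩
      · simpa only [Category.assoc, h₁] using ha hcd
      · simpa only [Category.assoc, h₂] using hb hcd
    refine ⟨hom l hl, ?_, ?_⟩
    · exact (hom_comp_hom _ _).trans (hom_eq_hom_iff.2 (Eqv.of_eq h₁))
    · exact (hom_comp_hom _ _).trans (hom_eq_hom_iff.2 (Eqv.of_eq h₂))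
  · intro T l l' h₁ h₂
    obtain ⟨l, hl, rfl⟩ := exists_hom_eq l
    obtain ⟨l', hl', rfl⟩ := exists_hom_eq l'
    rw [hom_comp_hom, hom_comp_hom, hom_eq_hom_iff] at h₁ h₂
    exact hom_eq_hom_iff.2 ((pbObj_eqv f g).2 ⟨h₁, h₂⟩)

instance : Limits.HasPullbacks 𝔄.SetPsh :=
  have h : ∀ {X Y Z : 𝔄.SetPsh} (f : Y ⟶ X) (g : Z ⟶ X), Limits.HasPullback f g := by
    intro X Y Z f g
    obtain ⟨f, hf, rfl⟩ := exists_hom_eq f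
    obtain ⟨g, hg, rfl⟩ := exists_hom_eq g
    exact (isPullback_pbObj f g hf hg).hasPullback
  Limits.hasPullbacks_of_hasLimit_cospan _

end Pullback

end SetPsh

end UniformPreorder

/-! ### Extracting exponentials from local cartesian closure. -/

open MonoidalCategory CartesianMonoidalCategory in
/-- Weak exponentials in slices, expressed with respect to arbitrary pullback squares. -/
theorem IsLocallyCartesianClosed.exists_exponential {C : Type*} [Category C]
    (H : IsLocallyCartesianClosed C) {X Y Z : C} (f : Y ⟶ X) (g : Z ⟶ X) :
    ∃ (E : C) (π : E ⟶ X), ∀ (P : C) (p : P ⟶ Y) (q : P ⟶ E), IsPullback p q f π →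
      ∃ ev : P ⟶ Z, ev ≫ g = p ≫ f ∧
        ∀ (V : C) (v : V ⟶ X) (P' : C) (p' : P' ⟶ Y) (q' : P' ⟶ V), IsPullback p' q' f v →
          ∀ k : P' ⟶ Z, k ≫ g = p' ≫ f → ∃ l : V ⟶ E, l ≫ π = v ∧
            ∀ n : P' ⟶ P, n ≫ p = p' → n ≫ q = q' ≫ l → n ≫ ev = k := by
  obtain ⟨_, ⟨_⟩⟩ := H X
  let A : Over X := Over.mk f
  let B : Over X := Over.mk g
  let E : Over X := (ihom A).obj B
  refine ⟨E.left, E.hom, fun P p q hP => ?_⟩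
  let PO : Over X := Over.mk (p ≫ f)
  let pO : PO ⟶ A := Over.homMk p
  let qO : PO ⟶ E := Over.homMk q hP.w.symm
  let ev : A ⊗ E ⟶ B := (ihom.ev A).app B
  refine ⟨(lift pO qO ≫ ev).left, Over.w (lift pO qO ≫ ev), ?_⟩
  intro V v P' p' q' hP' k hk
  let VO : Over X := Over.mk v
  let PO' : Over X := Over.mk (p' ≫ f)
  let pO' : PO' ⟶ A := Over.homMk p'
  let qO' : PO' ⟶ VO := Over.homMk q' hP'.w.symm
  let kO : PO' ⟶ B := Over.homMk k hk
  have hw : (fst A VO).left ≫ f = (snd A VO).left ≫ v :=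
    (Over.w (fst A VO)).trans (Over.w (snd A VO)).symm
  -- Comparison from the abstract product in the slice to the given pullback; it lets `k` be
  -- transposed as a map out of `A ⊗ VO`.
  let m : A ⊗ VO ⟶ PO' := Over.homMk (hP'.lift _ _ hw) (by
    change _ ≫ p' ≫ f = _
    rw [hP'.lift_fst_assoc]
    exact Over.w (fst A VO))
  have hm : lift pO' qO' ≫ m = 𝟙 _ := by
    refine Over.OverMorphism.ext (hP'.hom_ext ?_ ?_)
    · have h : (lift pO' qO' ≫ fst A VO).left = p' := by rw [lift_fst]; rfl
      rw [Over.comp_left] at h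
      change (_ ≫ hP'.lift _ _ hw) ≫ p' = 𝟙 _ ≫ p'
      rw [Category.assoc, hP'.lift_fst, h, Category.id_comp]
    · have h : (lift pO' qO' ≫ snd A VO).left = q' := by rw [lift_snd]; rfl
      rw [Over.comp_left] at h
      change (_ ≫ hP'.lift _ _ hw) ≫ q' = 𝟙 _ ≫ q'
      rw [Category.assoc, hP'.lift_snd, h, Category.id_comp]
  let l : VO ⟶ E := MonoidalClosed.curry (m ≫ kO)
  have hl : A ◁ l ≫ ev = m ≫ kO := by
    rw [← MonoidalClosed.uncurry_eq, MonoidalClosed.uncurry_curry]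
  refine ⟨l.left, Over.w l, fun n h₁ h₂ => ?_⟩
  let nO : PO' ⟶ PO := Over.homMk n (by
    change n ≫ p ≫ f = p' ≫ f
    rw [← Category.assoc, h₁])
  have h₁' : nO ≫ pO = pO' := Over.OverMorphism.ext h₁
  have h₂' : nO ≫ qO = qO' ≫ l := Over.OverMorphism.ext h₂
  have : nO ≫ lift pO qO ≫ ev = kO := by
    rw [← Category.assoc, comp_lift, h₁', h₂', ← lift_whiskerLeft, Category.assoc, hl,
      ← Category.assoc, hm, Category.id_comp]
  exact congrArg CommaMorphism.left this

/-! ### From local cartesian closure to relational completeness. -/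

namespace UniformPreorder

open FinitelyComplete UFam SetPsh

variable {𝔄 : UniformPreorder.{u}} [FinitelyComplete 𝔄]

/-- Relations become functions by taking the elements `(S, b, c)` of their graphs as arguments. The
predicate on such an argument only sees `b`, so a realizer of evaluation must relate a code and `b`
to `c`. -/
theorem relationallyComplete_of_isLocallyCartesianClosed
    (H : IsLocallyCartesianClosed 𝔄.SetPsh) : 𝔄.RelationallyComplete := by
  intro j k
  let X : 𝔄.UFam := ⟨𝔄.Car j → 𝔄.Car k → Prop, Pred.tt⟩
  let Y : 𝔄.UFam := ⟨{t : X.base × 𝔄.Car j × 𝔄.Car k // t.1 t.2.1 t.2.2}, ⟨j, fun t => t.1.2.1⟩⟩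
  let Z : 𝔄.UFam := ⟨X.base × 𝔄.Car k, ⟨k, Prod.snd⟩⟩
  let f : Y ⟶ X := ⟨fun t => t.1.1, Pred.le_tt _⟩
  let g : Z ⟶ X := ⟨Prod.fst, Pred.le_tt _⟩
  have hf := compat_disc (Y := disc X) f
  have hg := compat_disc (Y := disc X) g
  obtain ⟨E, π, hE⟩ := H.exists_exponential
    (hom (X := disc Y) (Y := disc X) f hf) (hom (X := disc Z) (Y := disc X) g hg)
  obtain ⟨π, hπ, rfl⟩ := exists_hom_eq π
  have hP := isPullback_pbObj (X := disc X) (Y := disc Y) (Z := E) f π hf hπ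
  obtain ⟨ev, hev, hE⟩ := hE _ _ _ hP
  obtain ⟨ev, hev', rfl⟩ := exists_hom_eq ev
  have hc : pbFst f π ≫ f = pbSnd f π ≫ π := pb_condition f π
  -- The predicate on `pb f π` is an explicit meet, whereas that on `pbObj f π` is not in the
  -- required form; `m` transports evaluation to the former.
  obtain ⟨m, hm₁, hm₂⟩ := exists_pbObjLift (X := disc X) (Y := disc Y) (Z := E) f π
    (disc_eqv.2 hc)
  have hle : Pred.inf (E.obj.pred.reindex fun t : (pb f π).base => t.1.2)
      (Y.pred.reindex fun t : (pb f π).base => t.1.1) ≤ Z.pred.reindex (Hom.fn (m ≫ ev)) :=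
    (Pred.le_inf (Pred.inf_le_right _ _) (Pred.inf_le_left _ _)).trans (Hom.le (m ≫ ev))
  refine ⟨E.obj.pred.idx, _, hle, fun i r hr => ?_⟩
  -- The generic element of sort `i`, mapped by `v` to the relation `r(a ∧ -, -)`; `κ` below returns
  -- the `c` of a graph element and is realized by `r`.
  let V : 𝔄.UFam := ⟨𝔄.Car i, ⟨i, fun a => a⟩⟩
  let v : V ⟶ X := ⟨fun a b c => r (meet a b) c, Pred.le_tt _⟩
  have hv := compat_disc (Y := disc X) v
  have hP' := isPullback_pbObj (X := disc X) (Y := disc Y) (Z := disc V) f v hf hv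
  let p' : (pbObj (X := disc X) (Y := disc Y) (Z := disc V) f v).obj ⟶ Y :=
    pbObjFst (X := disc X) (Y := disc Y) (Z := disc V) f v
  let q' : (pbObj (X := disc X) (Y := disc Y) (Z := disc V) f v).obj ⟶ V :=
    pbObjSnd (X := disc X) (Y := disc Y) (Z := disc V) f v
  have hpq : p' ≫ f = q' ≫ v :=
    disc_eqv.1 (pbObj_condition (X := disc X) (Y := disc Y) (Z := disc V) f v)
  let κ : (pbObj (X := disc X) (Y := disc Y) (Z := disc V) f v).obj ⟶ Z :=
    ⟨fun t => (Hom.fn (p' ≫ f) t, (Hom.fn p' t).1.2.2), by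
      refine (Pred.le_inf (Hom.le q') (Hom.le p')).trans (Pred.le_of (r := r) hr fun t => ?_)
      have h : (Hom.fn p' t).1.1 = fun b c => r (meet (Hom.fn q' t) b) c := fn_congr hpq t
      have h' := (Hom.fn p' t).2
      rw [h] at h'
      exact h'⟩
  obtain ⟨l, hl, hn⟩ := hE _ _ _ _ _ hP' (hom (Y := disc Z) κ (by
      intro W c d h
      have h := ((pbObj_eqv (X := disc X) (Y := disc Y) (Z := disc V) f v).1 h).1
      have h : c ≫ p' = d ≫ p' := disc_eqv.1 h
      refine disc_eqv.2 (hom_ext fun w => ?_)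
      have h := fn_congr h w
      exact Prod.ext (congrArg (Hom.fn f) h) (congrArg (fun y => y.1.2.2) h)))
    (hom_comp_hom_eq_iff.2 (disc_eqv.2 rfl))
  obtain ⟨l, hl', rfl⟩ := exists_hom_eq l
  have hlv : l ≫ π = v := disc_eqv.1 (hom_comp_hom_eq_hom_iff.1 hl)
  refine ⟨_, Hom.le l, fun a => ⟨_, ⟨a, rfl, rfl⟩, fun b c hb => ?_⟩⟩
  obtain ⟨n, hn₁, hn₂⟩ := hP.exists_lift
    (hom (X := pbObj (X := disc X) (Y := disc Y) (Z := disc V) f v) (Y := disc Y) p'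
      (compat_pbObjFst _ _))
    (hom (X := pbObj (X := disc X) (Y := disc Y) (Z := disc V) f v) (Y := disc V) q'
      (compat_pbObjSnd _ _) ≫ hom (X := disc V) l hl')
    (by rw [Category.assoc, hl]; exact hP'.w)
  have hn := hn n hn₁ hn₂
  obtain ⟨n, hnc, rfl⟩ := exists_hom_eq n
  have hn : n ≫ ev = κ := disc_eqv.1 (hom_comp_hom_eq_hom_iff.1 hn)
  have hn₁ : n ≫ pbObjFst (X := disc X) (Y := disc Y) (Z := E) f π = p' :=
    disc_eqv.1 (hom_comp_hom_eq_hom_iff.1 hn₁)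
  -- Equations into discrete objects are strict, but `E` need not be discrete. The compatibility of
  -- `ev` bridges this gap below, as its target is discrete.
  have hn₂ : E.Eqv (n ≫ pbObjSnd (X := disc X) (Y := disc Y) (Z := E) f π) (q' ≫ l) :=
    hom_comp_hom_eq_iff.1 hn₂
  have hfv : pbFst f v ≫ f = pbSnd f v ≫ v := pb_condition f v
  obtain ⟨τ, hτ₁, hτ₂⟩ := exists_pbObjLift (X := disc X) (Y := disc Y) (Z := disc V) f v
    (disc_eqv.2 hfv)
  have hτ₁ : τ ≫ p' = pbFst f v := hτ₁
  have hτ₂ : τ ≫ q' = pbSnd f v := hτ₂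
  obtain ⟨σ, hσ₁, hσ₂⟩ := exists_pbLift (f := f) (g := π) (pbFst f v) (pbSnd f v ≫ l)
    (hfv.trans (congrArg (fun x : V ⟶ X => pbSnd f v ≫ x) hlv.symm))
  have hστ : (pbObj (X := disc X) (Y := disc Y) (Z := E) f π).Eqv (σ ≫ m) (τ ≫ n) := by
    refine (pbObj_eqv _ _).2 ⟨disc_eqv.2 ?_, ?_⟩
    · rw [Category.assoc, Category.assoc, hm₁, hn₁]
      exact hσ₁.trans hτ₁.symm
    · rw [Category.assoc, Category.assoc, hm₂, hσ₂, ← hτ₂]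
      exact (hn₂.comp τ).symm
  have key : (σ ≫ m) ≫ ev = (τ ≫ n) ≫ ev := disc_eqv.1 (hev' hστ)
  rw [Category.assoc, Category.assoc, hn] at key
  -- At this point evaluation sends the code `l a` and the argument `b` to `c`, and its realizer
  -- relates the corresponding meet to `c`.
  let t : (pb f v).base := ⟨(⟨(fun b c => r (meet a b) c, b, c), hb⟩, a), rfl⟩
  have h₁ : (Hom.fn σ t).1.1 = t.1.1 := fn_congr hσ₁ t
  have h₂ : (Hom.fn σ t).1.2 = Hom.fn l a := fn_congr hσ₂ t
  have h₃ : Hom.fn p' (Hom.fn τ t) = t.1.1 := fn_congr hτ₁ t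
  refine ⟨Hom.fn σ t, ?_, ?_⟩
  · change meet (E.obj.pred.fn (Hom.fn σ t).1.2) (Y.pred.fn (Hom.fn σ t).1.1) = _
    rw [h₁, h₂]
    rfl
  · have h : Hom.fn (m ≫ ev) (Hom.fn σ t) = Hom.fn κ (Hom.fn τ t) := fn_congr key t
    change (Hom.fn (m ≫ ev) (Hom.fn σ t)).2 = c
    rw [h]
    change (Hom.fn p' (Hom.fn τ t)).1.2.2 = c
    rw [h₃]

end UniformPreorder

/-! ### From relational completeness to local cartesian closure. -/

namespace UniformPreorder

open FinitelyComplete UFam SetPsh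

variable {𝔄 : UniformPreorder.{u}} [FinitelyComplete 𝔄]

/-- Weak dependent products in `UFam 𝔄`: sections of `q` over the fibers of `u`, together with
a realizer. -/
theorem RelationallyComplete.exists_weakPi (h : 𝔄.RelationallyComplete) {X Y Z : 𝔄.UFam}
    (u : Y ⟶ X) (q : Z ⟶ Y) : ∃ (Q : 𝔄.UFam) (π : Q ⟶ X) (ev : pb π u ⟶ Z),
      ev ≫ q = pbSnd π u ∧ ∀ (V : 𝔄.UFam) (x : V ⟶ X) (s : pb x u ⟶ Z), s ≫ q = pbSnd x u →
        ∃ l : V ⟶ Q, l ≫ π = x ∧ ∀ (W : 𝔄.UFam) (b : W ⟶ pb x u) (b' : W ⟶ pb π u),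
          b ≫ pbFst x u ≫ l = b' ≫ pbFst π u → b ≫ pbSnd x u = b' ≫ pbSnd π u →
            b ≫ s = b' ≫ ev := by
  obtain ⟨e, ε, hε, H⟩ := h Y.pred.idx Z.pred.idx
  -- A base point, a code, and a section over the fiber that the code realizes. One section can have
  -- several codes, hence the product is only weak.
  let T : Type u := {t : (x : X.base) × 𝔄.Car e × ({y : Y.base // Hom.fn u y = x} → Z.base) //
    ∀ y, Hom.fn q (t.2.2 y) = y.1 ∧ ε (meet t.2.1 (Y.pred.fn y.1)) (Z.pred.fn (t.2.2 y))}
  let Q : 𝔄.UFam := ⟨T, Pred.inf (X.pred.reindex fun t : T => t.1.1) ⟨e, fun t : T => t.1.2.1⟩⟩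
  let π : Q ⟶ X := ⟨fun t => t.1.1, Pred.inf_le_left _ _⟩
  let ev : pb π u ⟶ Z := ⟨fun t => t.1.1.1.2.2 ⟨t.1.2, t.2.symm⟩, by
    let χ : 𝔄.Pred (pb π u).base := ⟨e, fun t => t.1.1.1.2.1⟩
    have h₁ : (pb π u).pred ≤ χ := (Hom.le (pbFst π u)).trans
      (Pred.reindex_mono (Hom.fn (pbFst π u)) (Pred.inf_le_right _ _))
    refine (Pred.le_inf h₁ (Hom.le (pbSnd π u))).trans (Pred.le_of (r := ε) hε fun t => ?_)
    exact (t.1.1.2 ⟨t.1.2, t.2.symm⟩).2⟩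
  refine ⟨Q, π, ev, hom_ext fun t => (t.1.1.2 ⟨t.1.2, t.2.symm⟩).1, fun V x s hs => ?_⟩
  obtain ⟨r', hr', h'⟩ := H _ _ (Hom.le s)
  -- The code depends only on the value of the predicate of `V`, and `r'` relates that value to it;
  -- so `r'` realizes the transpose.
  choose η hη hη' using h'
  let l : V ⟶ Q := ⟨fun v => ⟨⟨Hom.fn x v, η (V.pred.fn v), fun y => Hom.fn s ⟨(v, y.1), y.2.symm⟩⟩,
      fun y => ⟨fn_congr hs ⟨(v, y.1), y.2.symm⟩,
        hη' _ _ _ ⟨⟨(v, y.1), y.2.symm⟩, rfl, rfl⟩⟩⟩,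
    Pred.le_inf (Hom.le x) (Pred.le_of (ψ := ⟨e, fun v => η (V.pred.fn v)⟩) hr' fun v => hη _)⟩
  refine ⟨l, rfl, fun W b b' h₁ h₂ => hom_ext fun w => ?_⟩
  have h₁ : Hom.fn l (Hom.fn b w).1.1 = (Hom.fn b' w).1.1 := fn_congr h₁ w
  have h₂ : (Hom.fn b w).1.2 = (Hom.fn b' w).1.2 := fn_congr h₂ w
  change Hom.fn s (Hom.fn b w) = Hom.fn ev (Hom.fn b' w)
  -- The domain of a section depends on its base point, so the equations are substituted rather than
  -- rewritten.
  generalize Hom.fn b w = β at h₁ h₂ ⊢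
  generalize Hom.fn b' w = β' at h₁ h₂ ⊢
  obtain ⟨⟨v, y⟩, hv⟩ := β
  obtain ⟨⟨t, y'⟩, ht⟩ := β'
  obtain rfl : y = y' := h₂
  obtain rfl : Hom.fn l v = t := h₁
  rfl

/-- Universal quantification in the fibration of sieves. -/
theorem RelationallyComplete.exists_forall (h : 𝔄.RelationallyComplete) {X Y : 𝔄.UFam}
    (u : Y ⟶ X) (P : Siev Y) : ∃ Q : Siev X, ∀ (W : 𝔄.UFam) (x : W ⟶ X), Q.Sat x ↔
      ∀ (V : 𝔄.UFam) (t : V ⟶ W) (y : V ⟶ Y), t ≫ x = y ≫ u → P.Sat y := by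
  -- Weakness does no harm: truth of a sieve only asks for some factorization.
  obtain ⟨Q, π, ev, hev, H⟩ := h.exists_weakPi u P.arr
  refine ⟨⟨Q, π⟩, fun W x => ⟨?_, fun hx => ?_⟩⟩
  · rintro ⟨a, ha⟩ V t y hy
    have ha : a ≫ π = x := ha
    obtain ⟨b, -, hb⟩ := exists_pbLift (f := π) (g := u) (t ≫ a) y (by
      rw [Category.assoc, ha, hy])
    exact ⟨b ≫ ev, by rw [Category.assoc, hev, hb]⟩
  · obtain ⟨s, hs⟩ := hx _ (pbFst x u) (pbSnd x u) (pb_condition x u)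
    obtain ⟨l, hl, -⟩ := H W x s hs
    exact ⟨l, hl⟩

/-- Bounded universal quantification in the fibration of sieves. -/
theorem RelationallyComplete.exists_forall_imp (h : 𝔄.RelationallyComplete) {X Y : 𝔄.UFam}
    (u : Y ⟶ X) (H P : Siev Y) : ∃ Q : Siev X, ∀ (W : 𝔄.UFam) (x : W ⟶ X), Q.Sat x ↔
      ∀ (V : 𝔄.UFam) (t : V ⟶ W) (y : V ⟶ Y), t ≫ x = y ≫ u → H.Sat y → P.Sat y := by
  -- The bound is absorbed by quantifying over the domain of `H`.
  obtain ⟨Q, hQ⟩ := h.exists_forall (H.arr ≫ u) (P.reindex H.arr)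
  refine ⟨Q, fun W x => (hQ W x).trans ⟨?_, fun hx V t y hy => ?_⟩⟩
  · rintro hx V t _ hy ⟨y, rfl⟩
    exact Siev.sat_reindex.1 (hx V t y (hy.trans (Category.assoc _ _ _)))
  · exact Siev.sat_reindex.2 (hx V t _ (hy.trans (Category.assoc _ _ _).symm) ⟨y, rfl⟩)

/-- Weak exponentials in slices, with `B` the object of arguments: pairs of a function and an
element on which it is defined. -/
theorem RelationallyComplete.exists_weakExp (h : 𝔄.RelationallyComplete) {X Y Z : 𝔄.SetPsh}
    (f : Y.obj ⟶ X.obj) (g : Z.obj ⟶ X.obj) :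
    ∃ (Q : 𝔄.UFam) (π : Q ⟶ X.obj) (B : 𝔄.UFam) (w : B ⟶ Q) (y : B ⟶ Y.obj) (z : B ⟶ Z.obj),
      X.Eqv (y ≫ f) (w ≫ π) ∧ X.Eqv (z ≫ g) (w ≫ π) ∧
      (∀ (V : 𝔄.UFam) (a : V ⟶ Q) (c : V ⟶ Y.obj), X.Eqv (c ≫ f) (a ≫ π) →
        ∃ b : V ⟶ B, b ≫ w = a ∧ b ≫ y = c) ∧
      ∀ (V : 𝔄.SetPsh) (v : V.obj ⟶ X.obj) (k : (pbObj f v).obj ⟶ Z.obj),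
        Compat (pbObj f v) Z k → X.Eqv (k ≫ g) (pbObjFst f v ≫ f) →
        ∃ l : V.obj ⟶ Q, l ≫ π = v ∧ ∀ (W : 𝔄.UFam) (p : W ⟶ (pbObj f v).obj) (b : W ⟶ B),
          b ≫ w = p ≫ pbObjSnd f v ≫ l → Y.Eqv (p ≫ pbObjFst f v) (b ≫ y) →
            Z.Eqv (p ≫ k) (b ≫ z) := by
  -- Pairs `(y, x)` with `f y` equivalent to `x`. Strict fibers of `u` thereby account for the
  -- fibers of `f` up to equivalence, and strict weak products apply.
  let F : 𝔄.SetPsh := pbObj (Z := X) f (𝟙 X.obj)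
  let yy : F.obj ⟶ Y.obj := pbObjFst (Z := X) f (𝟙 X.obj)
  let u : F.obj ⟶ X.obj := pbObjSnd (Z := X) f (𝟙 X.obj)
  have hu : X.Eqv (yy ≫ f) u := by
    simpa only [Category.comp_id] using pbObj_condition (Z := X) f (𝟙 X.obj)
  have hF : ∀ {W : 𝔄.UFam} (c : W ⟶ Y.obj) (x : W ⟶ X.obj), X.Eqv (c ≫ f) x →
      ∃ d : W ⟶ F.obj, d ≫ yy = c ∧ d ≫ u = x := fun c x hc =>
    exists_pbObjLift (Z := X) f (𝟙 X.obj) (by rwa [Category.comp_id])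
  obtain ⟨Q, π, ev, hev, H⟩ := h.exists_weakPi u (pbObjSnd (Y := Z) (Z := F) g u)
  have hc := pb_condition π u
  refine ⟨Q, π, pb π u, pbFst π u, pbSnd π u ≫ yy, ev ≫ pbObjFst (Y := Z) (Z := F) g u,
    ?_, ?_, ?_, ?_⟩
  · rw [hc, Category.assoc]
    exact hu.comp _
  · rw [hc, ← hev, Category.assoc, Category.assoc]
    exact (pbObj_condition (Y := Z) (Z := F) g u).comp ev
  · intro V a c hac
    obtain ⟨d, hd₁, hd₂⟩ := hF c _ hac
    obtain ⟨b, hb₁, hb₂⟩ := exists_pbLift (f := π) (g := u) a d hd₂.symm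
    exact ⟨b, hb₁, by rw [← Category.assoc, hb₂, hd₁]⟩
  · intro V v k hk hkg
    have hvc := pb_condition v u
    obtain ⟨m, hm₁, hm₂⟩ := exists_pbObjLift f v (y := pbSnd v u ≫ yy) (z := pbFst v u) (by
      rw [hvc, Category.assoc]
      exact hu.comp _)
    obtain ⟨s, hs₁, hs₂⟩ := exists_pbObjLift (Y := Z) (Z := F) g u (y := m ≫ k) (z := pbSnd v u) (by
      have h₁ := hkg.comp m
      rw [← Category.assoc m _ f, hm₁, Category.assoc] at h₁
      rw [Category.assoc]
      exact h₁.trans (hu.comp _))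
    obtain ⟨l, hl, H⟩ := H _ v s hs₂
    refine ⟨l, hl, fun W p b hb hpb => ?_⟩
    obtain ⟨β, hβ₁, hβ₂⟩ := exists_pbLift (f := v) (g := u) (p ≫ pbObjSnd f v) (b ≫ pbSnd π u) (by
      rw [Category.assoc, Category.assoc, ← hc, ← Category.assoc b, hb]
      simp only [Category.assoc, hl])
    have hβb : β ≫ s = b ≫ ev := H W β b (by rw [← Category.assoc, hβ₁, hb, Category.assoc]) hβ₂
    -- The arguments agree only up to equivalence in `Y`; the compatibility of `k` absorbs the
    -- difference.
    have hpm : (pbObj f v).Eqv p (β ≫ m) := by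
      refine (pbObj_eqv f v).2 ⟨?_, Eqv.of_eq ?_⟩
      · rw [Category.assoc, hm₁, ← Category.assoc, hβ₂, Category.assoc]
        exact hpb
      · rw [Category.assoc, hm₂, hβ₁]
    have h₂ := hk hpm
    rwa [Category.assoc, ← hs₁, ← Category.assoc, hβb, Category.assoc] at h₂

/-- Exponentials in slices of `Set{𝔄}` in terms of tracking morphisms: the weak exponential is
restricted to the functions that respect the equivalence relations, which are identified if they
are pointwise equivalent. -/
theorem RelationallyComplete.exists_exponential (h : 𝔄.RelationallyComplete) {X Y Z : 𝔄.SetPsh}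
    (f : Y.obj ⟶ X.obj) (g : Z.obj ⟶ X.obj) :
    ∃ (E : 𝔄.SetPsh) (π : E.obj ⟶ X.obj) (_ : Compat E X π) (ev : (pbObj f π).obj ⟶ Z.obj)
      (_ : Compat (pbObj f π) Z ev), X.Eqv (ev ≫ g) (pbObjFst f π ≫ f) ∧
      ∀ (V : 𝔄.SetPsh) (v : V.obj ⟶ X.obj) (_ : Compat V X v) (k : (pbObj f v).obj ⟶ Z.obj),
        Compat (pbObj f v) Z k → X.Eqv (k ≫ g) (pbObjFst f v ≫ f) →
        (∃ l : V.obj ⟶ E.obj, Compat V E l ∧ X.Eqv (l ≫ π) v ∧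
          ∀ n : (pbObj f v).obj ⟶ (pbObj f π).obj, Compat _ _ n → Y.Eqv (n ≫ pbObjFst f π) (pbObjFst f v) →
            E.Eqv (n ≫ pbObjSnd f π) (pbObjSnd f v ≫ l) → Z.Eqv (n ≫ ev) k) ∧
        ∀ l l' : V.obj ⟶ E.obj, Compat V E l → Compat V E l' → X.Eqv (l ≫ π) v → X.Eqv (l' ≫ π) v →
          (∀ n : (pbObj f v).obj ⟶ (pbObj f π).obj, Compat _ _ n → Y.Eqv (n ≫ pbObjFst f π) (pbObjFst f v) →
            E.Eqv (n ≫ pbObjSnd f π) (pbObjSnd f v ≫ l) → Z.Eqv (n ≫ ev) k) →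
          (∀ n : (pbObj f v).obj ⟶ (pbObj f π).obj, Compat _ _ n → Y.Eqv (n ≫ pbObjFst f π) (pbObjFst f v) →
            E.Eqv (n ≫ pbObjSnd f π) (pbObjSnd f v ≫ l') → Z.Eqv (n ≫ ev) k) → E.Eqv l l' := by
  obtain ⟨Q, π, B, w, y, z, hy, hz, hB, hQ⟩ := h.exists_weakExp (X := X) (Y := Y) (Z := Z) f g
  obtain ⟨S₀, hS₀⟩ := h.exists_forall_imp (pair (fst B B ≫ w) (snd B B ≫ w))
    (Y.rel.sub (fst B B ≫ y) (snd B B ≫ y)) (Z.rel.sub (fst B B ≫ z) (snd B B ≫ z))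
  -- Equivalent arguments have equivalent values: a partial equivalence relation on `Q`, whose
  -- reflexive elements are the functions respecting equivalence.
  obtain ⟨S, hS⟩ : ∃ S : Siev (prod Q Q), ∀ {W : 𝔄.UFam} (a a' : W ⟶ Q), S.Sat (pair a a') ↔
      X.Eqv (a ≫ π) (a' ≫ π) ∧ ∀ (V : 𝔄.UFam) (t : V ⟶ W) (b b' : V ⟶ B), b ≫ w = t ≫ a →
        b' ≫ w = t ≫ a' → Y.Eqv (b ≫ y) (b' ≫ y) → Z.Eqv (b ≫ z) (b' ≫ z) := by
    refine ⟨Siev.inf (X.rel.sub (fst Q Q ≫ π) (snd Q Q ≫ π)) S₀, fun {W} a a' => ?_⟩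
    rw [Siev.sat_inf, Siev.sat_sub, hS₀]
    refine and_congr Iff.rfl ⟨fun H V t b b' hb hb' hbb => ?_, fun H V t β hβ hβ' => ?_⟩
    · refine Siev.sat_sub.1 (H V t (pair b b') ?_ (Siev.sat_sub.2 hbb))
      change pair (t ≫ a) (t ≫ a') = pair (b ≫ w) (b' ≫ w)
      rw [hb, hb']
    · refine Siev.sat_sub.2 (H V t (β ≫ fst B B) (β ≫ snd B B) ?_ ?_ (Siev.sat_sub.1 hβ'))
      · exact (congrArg (· ≫ fst Q Q) hβ).symm
      · exact (congrArg (· ≫ snd Q Q) hβ).symm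
  have S_symm : ∀ {W : 𝔄.UFam} {a a' : W ⟶ Q}, S.Sat (pair a a') → S.Sat (pair a' a) := by
    intro W a a' H
    rw [hS] at H ⊢
    exact ⟨H.1.symm, fun V t b b' hb hb' hbb => (H.2 V t b' b hb' hb hbb.symm).symm⟩
  have S_trans : ∀ {W : 𝔄.UFam} {a a' a'' : W ⟶ Q}, S.Sat (pair a a') → S.Sat (pair a' a'') →
      S.Sat (pair a a'') := by
    intro W a a' a'' H H'
    rw [hS] at H H' ⊢
    refine ⟨H.1.trans H'.1, fun V t b b' hb hb' hbb => ?_⟩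
    -- Transitivity needs a value of the middle function `a'`, here taken at the argument of `b`.
    obtain ⟨b₀, h₁, h₂⟩ := hB V (t ≫ a') (b ≫ y) (by
      have h₁ := hy.comp b
      rw [← Category.assoc b w, hb] at h₁
      have h₂ := H.1.comp t
      rw [← Category.assoc t a, ← Category.assoc t a'] at h₂
      rw [Category.assoc]
      exact h₁.trans h₂)
    exact (H.2 V t b b₀ hb h₁ (Eqv.of_eq h₂.symm)).trans
      (H'.2 V t b₀ b' h₁ hb' ((Eqv.of_eq h₂).trans hbb))
  obtain ⟨E, ι, hE, hlift⟩ : ∃ (E : 𝔄.SetPsh) (ι : E.obj ⟶ Q),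
      (∀ {W : 𝔄.UFam} {c d : W ⟶ E.obj}, E.Eqv c d ↔ S.Sat (pair (c ≫ ι) (d ≫ ι))) ∧
      ∀ {W : 𝔄.UFam} (a : W ⟶ Q), S.Sat (pair a a) → ∃ c : W ⟶ E.obj, c ≫ ι = a := by
    let E₀ : Siev Q := S.sub (𝟙 Q) (𝟙 Q)
    have hE₀ : ∀ {W : 𝔄.UFam} {c d : W ⟶ E₀.dom}, (S.sub (fst _ _ ≫ E₀.arr)
        (snd _ _ ≫ E₀.arr)).Sat (pair c d) ↔ S.Sat (pair (c ≫ E₀.arr) (d ≫ E₀.arr)) :=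
      Siev.sat_sub
    refine ⟨ofSat E₀.dom _
      (fun W c => hE₀.2 ((Siev.sat_sub (s := 𝟙 Q) (t := 𝟙 Q) (v := c ≫ E₀.arr)).1 (E₀.sat_arr.comp c)))
      (fun _ _ _ H => hE₀.2 (S_symm (hE₀.1 H)))
      (fun _ _ _ _ H H' => hE₀.2 (S_trans (hE₀.1 H) (hE₀.1 H'))), E₀.arr, hE₀, fun a ha => ?_⟩
    exact Siev.sat_sub.2 ha
  have hπ : Compat E X (ι ≫ π) := fun W c d H => by
    simpa only [Category.assoc] using ((hS _ _).1 (hE.1 H)).1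
  -- The generic function together with the generic argument; its value is the evaluation map.
  obtain ⟨b₀, hb₀w, hb₀y⟩ := hB _ (pbObjSnd f (ι ≫ π) ≫ ι) (pbObjFst f (ι ≫ π)) (by
    rw [Category.assoc]
    exact pbObj_condition f (ι ≫ π))
  have hev : ∀ {W : 𝔄.UFam} (p : W ⟶ (pbObj f (ι ≫ π)).obj) (a : W ⟶ E.obj) (b : W ⟶ B),
      E.Eqv (p ≫ pbObjSnd f (ι ≫ π)) a → b ≫ w = a ≫ ι →
      Y.Eqv (p ≫ pbObjFst f (ι ≫ π)) (b ≫ y) → Z.Eqv (p ≫ b₀ ≫ z) (b ≫ z) := by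
    intro W p a b hpa hb hpb
    rw [← Category.assoc]
    refine ((hS _ _).1 (hE.1 hpa)).2 W (𝟙 W) (p ≫ b₀) b ?_ ?_ ?_
    · rw [Category.id_comp, Category.assoc, Category.assoc, hb₀w]
    · rw [Category.id_comp, hb]
    · rwa [Category.assoc, hb₀y]
  refine ⟨E, ι ≫ π, hπ, b₀ ≫ z, fun W c d H => ?_, ?_, fun V v hv k hk hkg => ⟨?_, ?_⟩⟩
  · have H := (pbObj_eqv _ _).1 H
    rw [← Category.assoc d]
    exact hev c (d ≫ pbObjSnd f (ι ≫ π)) (d ≫ b₀) H.2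
      (by rw [Category.assoc, Category.assoc, hb₀w]) (by rw [Category.assoc, hb₀y]; exact H.1)
  · rw [← hb₀y, Category.assoc, Category.assoc]
    exact (hz.trans hy.symm).comp b₀
  · obtain ⟨l₀, hl₀, hQ⟩ := hQ V v k hk hkg
    -- Values of `l₀` are values of `k`, so compatibility of `k` gives this. The reflexive case
    -- places `l₀` in `E`; the general case makes its lift compatible.
    have key : ∀ {W : 𝔄.UFam} {c c' : W ⟶ V.obj}, V.Eqv c c' →
        S.Sat (pair (c ≫ l₀) (c' ≫ l₀)) := by
      intro W c c' hcc
      refine (hS _ _).2 ⟨?_, fun T t b b' hb hb' hbb => ?_⟩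
      · rw [Category.assoc, Category.assoc, hl₀]
        exact hv hcc
      · have aux : ∀ (b : T ⟶ B) (c : W ⟶ V.obj), b ≫ w = t ≫ c ≫ l₀ →
            ∃ p : T ⟶ (pbObj f v).obj, p ≫ pbObjFst f v = b ≫ y ∧ p ≫ pbObjSnd f v = t ≫ c ∧
              Z.Eqv (p ≫ k) (b ≫ z) := by
          intro b c hb
          obtain ⟨p, hp₁, hp₂⟩ := exists_pbObjLift f v (y := b ≫ y) (z := t ≫ c) (by
            have h₁ := hy.comp b
            rw [← Category.assoc b w, hb] at h₁
            simpa only [Category.assoc, hl₀] using h₁)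
          refine ⟨p, hp₁, hp₂, hQ T p b ?_ (Eqv.of_eq hp₁)⟩
          rw [hb, ← Category.assoc p, hp₂, Category.assoc]
        obtain ⟨p, hp₁, hp₂, hp⟩ := aux b c hb
        obtain ⟨p', hp₁', hp₂', hp'⟩ := aux b' c' hb'
        refine hp.symm.trans (Eqv.trans (hk ((pbObj_eqv _ _).2 ⟨?_, ?_⟩)) hp')
        · rwa [hp₁, hp₁']
        · rw [hp₂, hp₂']
          exact hcc.comp t
    obtain ⟨l, hl⟩ := hlift l₀ (by simpa using key (Eqv.refl V (𝟙 V.obj)))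
    refine ⟨l, fun W c d hcd => hE.2 ?_, Eqv.of_eq ?_, fun n _ hn₁ hn₂ => ?_⟩
    · rw [Category.assoc, Category.assoc, hl]
      exact key hcd
    · rw [← Category.assoc, hl, hl₀]
    · obtain ⟨b, hb₁, hb₂⟩ := hB _ (pbObjSnd f v ≫ l₀) (pbObjFst f v) (by
        rw [Category.assoc, hl₀]
        exact pbObj_condition f v)
      have h₁ := hev n _ b hn₂ (by rw [hb₁, Category.assoc, hl]) (by rwa [hb₂])
      have h₂ := hQ _ (𝟙 _) b (by rw [hb₁, Category.id_comp])
        (Eqv.of_eq (by rw [hb₂, Category.id_comp]))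
      rw [Category.id_comp] at h₂
      exact h₁.trans h₂.symm
  -- Every value of a transpose of `k` is equivalent to a value of `k`, so two transposes are
  -- pointwise equivalent, which is equality in `E`.
  · have key : ∀ l : V.obj ⟶ E.obj, Compat V E l → X.Eqv (l ≫ ι ≫ π) v →
        (∀ n : (pbObj f v).obj ⟶ (pbObj f (ι ≫ π)).obj, Compat _ _ n →
          Y.Eqv (n ≫ pbObjFst f (ι ≫ π)) (pbObjFst f v) →
          E.Eqv (n ≫ pbObjSnd f (ι ≫ π)) (pbObjSnd f v ≫ l) → Z.Eqv (n ≫ b₀ ≫ z) k) →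
        ∀ {T : 𝔄.UFam} (t : T ⟶ V.obj) (b : T ⟶ B), b ≫ w = t ≫ l ≫ ι →
          ∃ p : T ⟶ (pbObj f v).obj, p ≫ pbObjFst f v = b ≫ y ∧ p ≫ pbObjSnd f v = t ∧
              Z.Eqv (p ≫ k) (b ≫ z) := by
      intro l hl hlv hn T t b hb
      obtain ⟨p, hp₁, hp₂⟩ := exists_pbObjLift f v (y := b ≫ y) (z := t) (by
        have h₁ := hy.comp b
        rw [← Category.assoc b w, hb] at h₁
        simp only [Category.assoc] at h₁ ⊢
        exact h₁.trans (hlv.comp t))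
      obtain ⟨n, hn₁, hn₂⟩ := exists_pbObjLift f (ι ≫ π) (y := pbObjFst f v)
        (z := pbObjSnd f v ≫ l) (by
          rw [Category.assoc]
          exact (pbObj_condition f v).trans (hlv.comp (pbObjSnd f v)).symm)
      have hnk := hn n (fun W c d hcd => by
          have hcd := (pbObj_eqv _ _).1 hcd
          refine (pbObj_eqv _ _).2 ⟨?_, ?_⟩
          · simpa only [Category.assoc, hn₁] using hcd.1
          · simpa only [Category.assoc, hn₂] using hl hcd.2) (Eqv.of_eq hn₁) (Eqv.of_eq hn₂)
      refine ⟨p, hp₁, hp₂, (hnk.comp p).symm.trans ?_⟩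
      rw [← Category.assoc p]
      refine hev (p ≫ n) (t ≫ l) b (Eqv.of_eq ?_) (by rw [hb, Category.assoc]) (Eqv.of_eq ?_)
      · rw [Category.assoc, hn₂, ← Category.assoc, hp₂]
      · rw [Category.assoc, hn₁, hp₁]
    intro l l' hl hl' hlv hlv' H H'
    refine hE.2 ((hS _ _).2 ⟨?_, fun T t b b' hb hb' hbb => ?_⟩)
    · rw [Category.assoc, Category.assoc]
      exact hlv.trans hlv'.symm
    · obtain ⟨p, hp₁, hp₂, hp⟩ := key l hl hlv H t b hb
      obtain ⟨p', hp₁', hp₂', hp'⟩ := key l' hl' hlv' H' t b' hb'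
      refine hp.symm.trans (Eqv.trans (hk ((pbObj_eqv _ _).2 ⟨?_, Eqv.of_eq ?_⟩)) hp')
      · rwa [hp₁, hp₁']
      · rw [hp₂, hp₂']

theorem RelationallyComplete.isLocallyCartesianClosed (h : 𝔄.RelationallyComplete) :
    IsLocallyCartesianClosed 𝔄.SetPsh := by
  refine isLocallyCartesianClosed_of_exists_exponential fun {X Y Z} f g => ?_
  obtain ⟨f, hf, rfl⟩ := exists_hom_eq f
  obtain ⟨g, hg, rfl⟩ := exists_hom_eq g
  obtain ⟨E, π, hπ, ev, hev, hevg, H⟩ := h.exists_exponential f g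
  refine ⟨E, hom π hπ, pbObj f π, _, _, isPullback_pbObj f π hf hπ, hom ev hev,
    hom_comp_hom_eq_iff.2 hevg, fun V v => ?_⟩
  obtain ⟨v, hv, rfl⟩ := exists_hom_eq v
  refine ⟨pbObj f v, _, _, isPullback_pbObj f v hf hv, fun k hkg => ?_⟩
  obtain ⟨k, hk, rfl⟩ := exists_hom_eq k
  obtain ⟨⟨l, hl, hlv, hln⟩, hu⟩ := H V v hv k hk (hom_comp_hom_eq_iff.1 hkg)
  refine ⟨hom l hl, ⟨hom_comp_hom_eq_hom_iff.2 hlv, fun n h₁ h₂ => ?_⟩, fun l' hl' => ?_⟩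
  · obtain ⟨n, hn, rfl⟩ := exists_hom_eq n
    exact hom_comp_hom_eq_hom_iff.2 (hln n hn (hom_comp_hom_eq_hom_iff.1 h₁)
      (hom_comp_hom_eq_iff.1 h₂))
  · obtain ⟨l', hlc, rfl⟩ := exists_hom_eq l'
    refine hom_eq_hom_iff.2 (hu l' l hlc hl (hom_comp_hom_eq_hom_iff.1 hl'.1) hlv ?_ hln)
    exact fun n hn h₁ h₂ => hom_comp_hom_eq_hom_iff.1 (hl'.2 (hom n hn)
      (hom_comp_hom_eq_hom_iff.2 h₁) (hom_comp_hom_eq_iff.2 h₂))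

end UniformPreorder

theorem theorem4p10p3 (𝔄 : UniformPreorder.{u}) [UniformPreorder.FinitelyComplete 𝔄] :
    List.TFAE
      [𝔄.RelationallyComplete,
        (UniformPreorder.D 𝔄).HasImplication ∧ (UniformPreorder.D 𝔄).HasUniversalQuantification,
        IsLocallyCartesianClosed 𝔄.SetPsh] := by
  tfae_have 1 → 2 := fun h => ⟨h.hasImplication, h.hasUniversalQuantification⟩
  tfae_have 2 → 1 := fun h => UniformPreorder.relationallyComplete_of_D h.1 h.2
  tfae_have 1 → 3 := fun h => h.isLocallyCartesianClosed
  tfae_have 3 → 1 := UniformPreorder.relationallyComplete_of_isLocallyCartesianClosed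
  tfae_finish
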